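/- Let $\mathcal H$ be the hypergraph with vertex set $\{z, v_1, v_2, \ldots, v_9\}$ whose edges are $$\{z,v_1,v_3,v_5,v_8\},\quad \{z,v_2,v_4,v_7,v_9\},\quad \{v_1,v_4,v_6,v_8,v_9\},\quad \{v_9,v_1,v_2,v_3,v_4\},$$ $$\{v_i,v_{i+1},v_{i+2},v_{i+3},v_{i+4}\}\quad (1\le i\le 5).$$ Then $\mathcal H$ is a $5$-uniform hypergraph with $10$ vertices and $9$ edges, and the strong Ramsey game $\mathcal R^{(5)}(\mathcal H,\aleph_0)$ is a draw. Here $\mathcal R^{(5)}(\mathcal H,\aleph_0)$ is the following game. The board is the set of all $5$-element subsets of $\mathbb N$ (the edges of the complete $5$-uniform hypergraph on $\mathbb N$). Two players, the first player FP and the second player SP, alternately claim previously unclaimed edges, one edge per move, with FP moving first. A player wins if he is the first to have claimed all edges of a copy of $\mathcal H$, that is, of the image of $\mathcal H$ under an injection of its vertex set into $\mathbb N$. The game is a draw if neither player has a strategy which ensures that he wins after finitely many moves, however the opponent plays. -/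

import Mathlib

/-! ### Strong positional games on an infinite board -/

/-- The two players: `FP` makes the first move, `SP` the second. -/
inductive Player where
  | FP
  | SP

/-- The opponent of a player. -/
def Player.opponent : Player → Player
  | .FP => .SP
  | .SP => .FP

/-- Moves are numbered `0, 1, 2, …`; the players alternate and `FP` makes move `0`. -/
def mover (n : ℕ) : Player := if Even n then .FP else .SP

section StrongGame

variable {X : Type*}

/-- The sequence of the first `n` moves of the play `p`, in the order in which they were made. -/
def history (p : ℕ → X) (n : ℕ) : List X := (List.range n).map p

/-- The set of all elements which the player `P` has claimed after `t` moves (of both players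
together) of the play `p`. -/
def claimed (p : ℕ → X) (P : Player) (t : ℕ) : Set X :=
  {x | ∃ i < t, mover i = P ∧ p i = x}

/-- After `t` moves of the play `p`, the player `P` has claimed all elements of a winning set. -/
def HasWinningSet (F : Set (Finset X)) (p : ℕ → X) (P : Player) (t : ℕ) : Prop :=
  ∃ A ∈ F, (A : Set X) ⊆ claimed p P t

/-- `P` wins the play `p`: at some finite time he has claimed all elements of a winning set,
while his opponent has not done so up to that time (claimed sets only grow, so it
is enough to look at the opponent's set at this one time). What happens after that time is
irrelevant, so plays may be continued forever. -/
def Wins (F : Set (Finset X)) (p : ℕ → X) (P : Player) : Prop :=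
  ∃ t, HasWinningSet F p P t ∧ ¬ HasWinningSet F p P.opponent t

/-- A strategy answers every finite sequence of moves by an element that was not claimed before. -/
structure Strategy (X : Type*) where
  move : List X → X
  legal : ∀ h, move h ∉ h

/-- In the play `p`, all moves of the player `P` are made according to `σ`. -/
def Strategy.Follows (σ : Strategy X) (P : Player) (p : ℕ → X) : Prop :=
  ∀ n, mover n = P → p n = σ.move (history p n)

/-- The player `P` has a strategy which makes him win, after finitely many moves, every play of
the strong game `(X, F)`. As the board is infinite, plays are infinite sequences of
distinct elements. -/
def HasWinningStrategy [Infinite X] (F : Set (Finset X)) (P : Player) : Prop :=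
  ∃ σ : Strategy X, ∀ p : ℕ → X, Function.Injective p → σ.Follows P p → Wins F p P

/-- The strong game `(X, F)` is a draw: no player has a strategy to ensure his win in finitely
many moves. -/
def IsDraw [Infinite X] (F : Set (Finset X)) : Prop :=
  ∀ P : Player, ¬ HasWinningStrategy F P

end StrongGame

/-! ### Strong Ramsey games on the complete uniform hypergraph on `ℕ` -/

/-- Every edge has exactly `k` vertices. -/
def Hypergraph.IsUniform {α : Type*} (H : Hypergraph α) (k : ℕ) : Prop :=
  ∀ e ∈ H.edgeSet, e.encard = k

/-- The edges of the complete `k`-uniform hypergraph with vertex set `ℕ`. -/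
abbrev CompleteEdge (k : ℕ) : Type := {e : Finset ℕ // e.card = k}

instance (k : ℕ) [NeZero k] : Infinite (CompleteEdge k) := by
  refine Infinite.of_injective
    (fun n : ℕ => (⟨(Finset.range k).map (addLeftEmbedding n), by simp⟩ : CompleteEdge k)) ?_
  intro a b hab
  have h : (Finset.range k).map (addLeftEmbedding a) = (Finset.range k).map (addLeftEmbedding b) :=
    congrArg Subtype.val hab
  have hk : 0 < k := Nat.pos_of_ne_zero (NeZero.ne k)
  have ha : a ∈ (Finset.range k).map (addLeftEmbedding b) := by
    rw [← h]
    exact Finset.mem_map.2 ⟨0, by simpa using hk, by simp⟩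
  have hb : b ∈ (Finset.range k).map (addLeftEmbedding a) := by
    rw [h]
    exact Finset.mem_map.2 ⟨0, by simpa using hk, by simp⟩
  simp only [Finset.mem_map, addLeftEmbedding_apply] at ha hb
  obtain ⟨i, -, hi⟩ := ha
  obtain ⟨j, -, hj⟩ := hb
  omega

/-- The winning sets of the strong Ramsey game of `H` on the complete `k`-uniform hypergraph on
`ℕ`: the edge sets of the copies of `H`, that is, of the images of `H` under
injections of its vertex set into `ℕ`. -/
def ramseyWinningSets {α : Type*} (k : ℕ) (H : Hypergraph α) : Set (Finset (CompleteEdge k)) :=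
  {A | ∃ f : α → ℕ, Set.InjOn f H.vertexSet ∧
    (fun e : CompleteEdge k => ((e : Finset ℕ) : Set ℕ)) '' A = (H.image f).edgeSet}

/-! ### The hypergraph -/

/-- The nine edges `r, g, a, b, e₁, …, e₅`; the vertex `z` is `0` and `vᵢ` is `i`. -/
def drawEdges : Finset (Finset (Fin 10)) :=
  {{0, 1, 3, 5, 8},
   {0, 2, 4, 7, 9},
   {1, 4, 6, 8, 9},
   {9, 1, 2, 3, 4},
   {1, 2, 3, 4, 5},
   {2, 3, 4, 5, 6},
   {3, 4, 5, 6, 7},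
   {4, 5, 6, 7, 8},
   {5, 6, 7, 8, 9}}

/-- The hypergraph with the ten vertices `0, …, 9` and the nine edges listed in `drawEdges`. -/
def drawHypergraph : Hypergraph (Fin 10) where
  vertexSet := Set.univ
  edgeSet := {e | ∃ d ∈ drawEdges, (d : Set (Fin 10)) = e}
  subset_vertexSet_of_mem_edgeSet' := fun e _ => Set.subset_univ e

/-! Either player can avoid losing, so neither has a winning strategy. Call the seven edges without
the apex `z` the core. The player builds a core in seven moves and then threatens forever: for a
fresh vertex `w` one of the two apex edges at `w` is claimed, and the opponent must take the other
one at once or lose.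

Building: the player makes the tight path `e₁, …, e₅` with fresh vertices and closes it by `b`. The
six edges are permuted by a reflection, so `a` and its mirror image both complete a core, and a
single move cannot stop both. If the move before `b` spoils this plan, the reversed path needs three
different edges, which are still free (`survives_of_path`).

Threatening: every vertex except `z` has degree at least four, and a fresh apex lies in few edges of
the opponent. Hence a forced reply can only serve the opponent as an apex edge of a copy whose core
was already there. If each core of the opponent that has one side of the player's core as a side
also has the other one, the missing edge of that copy is the one the player has claimed. When all
the opponent's cores lie within eight edges, they nearly coincide by rigidity, and one of the two
orders of claiming apex edges has this property (`exists_harmless_side`, `survivesToMove_of_core`).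

Before the forcing starts, the opponent's own threats must be met. When the player's core is
complete the opponent has seven edges and is to move, so a threat is a whole copy minus one edge. If
a core edge is missing, one block ends all threats. If an apex edge is missing, the opponent may go
on threatening at new apices, each of which is blocked; the first quiet move lets the player begin
(`survives_of_core`). Rigidity of partial copies is a finite computation with intersection sizes. -/

/-! ### Surviving forever against an opponent -/

section Survival

variable {X : Type*}

/-- The set `B` contains a winning set. -/
def ContainsWinningSet (F : Set (Finset X)) (B : Finset X) : Prop := ∃ W ∈ F, W ⊆ B

theorem ContainsWinningSet.mono {F : Set (Finset X)} {A B : Finset X}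
    (h : ContainsWinningSet F A) (hAB : A ⊆ B) : ContainsWinningSet F B :=
  let ⟨W, hW, hWA⟩ := h
  ⟨W, hW, hWA.trans hAB⟩

theorem history_succ (p : ℕ → X) (n : ℕ) : history p (n + 1) = history p n ++ [p n] := by
  simp [history, List.range_succ]

theorem length_history (p : ℕ → X) (n : ℕ) : (history p n).length = n := by
  simp [history]

/-- Every rule that prescribes the next move is followed by some play. -/
theorem exists_play (next : List X → X) : ∃ p : ℕ → X, ∀ n, p n = next (history p n) := by
  let hist : ℕ → List X := fun n => Nat.rec [] (fun _ h => h ++ [next h]) n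
  refine ⟨fun n => next (hist n), fun n => ?_⟩
  have : history (fun n => next (hist n)) n = hist n := by
    induction n with
    | zero => rfl
    | succ n ih => rw [history_succ, ih]
  rw [this]

theorem injective_of_notMem_history {p : ℕ → X} (h : ∀ n, p n ∉ history p n) :
    Function.Injective p := by
  have key : ∀ i j, i < j → p i ≠ p j := by
    intro i j hij heq
    exact h j (by rw [← heq]; exact List.mem_map_of_mem (List.mem_range.2 hij))
  intro i j hij
  rcases lt_trichotomy i j with h' | h' | h'
  · exact absurd hij (key i j h')
  · exact h'
  · exact absurd hij.symm (key j i h')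

variable [DecidableEq X]

/-- A family of positions (own elements, opponent's elements), with the opponent to move, in which
the player can stay forever without the opponent being the first to complete a winning set. -/
def IsSurvivalFamily (F : Set (Finset X)) (S : Set (Finset X × Finset X)) : Prop :=
  ∀ A B, (A, B) ∈ S → ∀ x, x ∉ A → x ∉ B →
    (ContainsWinningSet F (insert x B) → ContainsWinningSet F A) ∧
      ∃ y, y ∉ A ∧ y ∉ insert x B ∧ (insert y A, insert x B) ∈ S

/-- The player owning `A` can avoid losing against the player owning `B`, who is to move. -/
def Survives (F : Set (Finset X)) (A B : Finset X) : Prop :=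
  ∃ S, IsSurvivalFamily F S ∧ (A, B) ∈ S

/-- The player owning `A`, who is to move, can avoid losing against the player owning `B`. -/
def SurvivesToMove (F : Set (Finset X)) (A B : Finset X) : Prop :=
  ∃ y, y ∉ A ∧ y ∉ B ∧ Survives F (insert y A) B

variable {F : Set (Finset X)} {A B : Finset X}

theorem Survives.step (h : Survives F A B) {x : X} (hA : x ∉ A) (hB : x ∉ B) :
    (ContainsWinningSet F (insert x B) → ContainsWinningSet F A) ∧
      SurvivesToMove F A (insert x B) := by
  obtain ⟨S, hS, hmem⟩ := h
  obtain ⟨h1, y, hyA, hyB, hy⟩ := hS A B hmem x hA hB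
  exact ⟨h1, y, hyA, hyB, S, hS, hy⟩

/-- Surviving positions themselves form a survival family, so a play may leave `S` for any position
already known to survive. -/
theorem Survives.coinduct (S : Set (Finset X × Finset X))
    (hS : ∀ A B, (A, B) ∈ S → ∀ x, x ∉ A → x ∉ B →
      (ContainsWinningSet F (insert x B) → ContainsWinningSet F A) ∧
        ∃ y, y ∉ A ∧ y ∉ insert x B ∧
          ((insert y A, insert x B) ∈ S ∨ Survives F (insert y A) (insert x B)))
    (h : (A, B) ∈ S) : Survives F A B := by
  refine ⟨S ∪ {q | Survives F q.1 q.2}, ?_, Or.inl h⟩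
  rintro A B (hAB | hAB) x hxA hxB
  · exact hS A B hAB x hxA hxB
  · obtain ⟨h1, y, hyA, hyB, hy⟩ := Survives.step (A := A) (B := B) hAB hxA hxB
    exact ⟨h1, y, hyA, hyB, Or.inr hy⟩

theorem Survives.of_step
    (h : ∀ x, x ∉ A → x ∉ B →
      (ContainsWinningSet F (insert x B) → ContainsWinningSet F A) ∧
        SurvivesToMove F A (insert x B)) : Survives F A B := by
  refine Survives.coinduct {(A, B)} ?_ rfl
  rintro A' B' hq x hxA hxB
  obtain ⟨rfl, rfl⟩ := Prod.mk.inj hq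
  obtain ⟨h1, y, hyA, hyB, hy⟩ := h x hxA hxB
  exact ⟨h1, y, hyA, hyB, Or.inr hy⟩

theorem Survives.of_containsWinningSet [Infinite X] (h : ContainsWinningSet F A) :
    Survives F A B := by
  refine Survives.coinduct {q | ContainsWinningSet F q.1} ?_ h
  intro A B hA x _ _
  obtain ⟨y, hy⟩ := Infinite.exists_notMem_finset (A ∪ insert x B)
  rw [Finset.mem_union, not_or] at hy
  exact ⟨fun _ => hA, y, hy.1, hy.2, Or.inl (ContainsWinningSet.mono hA (Finset.subset_insert _ _))⟩

/-! ### From survival to the absence of a winning strategy -/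

open Classical in
/-- The elements of the history `h` which were claimed by `P`. -/
noncomputable def ownMoves (P : Player) (h : List X) : Finset X :=
  ((h.zipIdx.filter fun q => mover q.2 = P).map Prod.fst).toFinset

theorem ownMoves_concat_self {P : Player} {h : List X} (hP : mover h.length = P) (x : X) :
    ownMoves P (h ++ [x]) = insert x (ownMoves P h) := by
  ext y
  simp [ownMoves, List.zipIdx_append, hP]

theorem ownMoves_concat_of_ne {P : Player} {h : List X} (hP : mover h.length ≠ P) (x : X) :
    ownMoves P (h ++ [x]) = ownMoves P h := by
  ext y
  simp [ownMoves, List.zipIdx_append, hP]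

theorem mem_of_mem_ownMoves {P : Player} {h : List X} {x : X} (hx : x ∈ ownMoves P h) : x ∈ h := by
  simp only [ownMoves, List.mem_toFinset, List.mem_map, List.mem_filter] at hx
  obtain ⟨⟨y, i⟩, ⟨hy, -⟩, rfl⟩ := hx
  exact List.fst_mem_of_mem_zipIdx hy

theorem claimed_eq_ownMoves (p : ℕ → X) (P : Player) (n : ℕ) :
    claimed p P n = (ownMoves P (history p n) : Set X) := by
  induction n with
  | zero => ext; simp [claimed, ownMoves, history]
  | succ n ih =>
    have hsucc : claimed p P (n + 1) = claimed p P n ∪ {x | mover n = P ∧ p n = x} := by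
      ext x
      simp only [claimed, Set.mem_ofPred_eq, Set.mem_union, Nat.lt_succ_iff_lt_or_eq]
      constructor
      · rintro ⟨i, hi | rfl, h⟩
        · exact Or.inl ⟨i, hi, h⟩
        · exact Or.inr h
      · rintro (⟨i, hi, h⟩ | h)
        · exact ⟨i, Or.inl hi, h⟩
        · exact ⟨n, Or.inr rfl, h⟩
    rw [hsucc, ih, history_succ]
    by_cases hP : mover n = P
    · rw [ownMoves_concat_self (by rwa [length_history])]
      ext x
      simp [hP, eq_comm]
    · rw [ownMoves_concat_of_ne (by rwa [length_history])]
      ext x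
      simp [hP]

theorem hasWinningSet_iff (F : Set (Finset X)) (p : ℕ → X) (P : Player) (n : ℕ) :
    HasWinningSet F p P n ↔ ContainsWinningSet F (ownMoves P (history p n)) := by
  simp only [HasWinningSet, ContainsWinningSet, claimed_eq_ownMoves, Finset.coe_subset]

theorem Player.ne_opponent (P : Player) : P ≠ P.opponent := by cases P <;> simp [Player.opponent]

theorem mover_eq_or (P : Player) (n : ℕ) : mover n = P ∨ mover n = P.opponent := by
  unfold mover
  split <;> cases P <;> simp [Player.opponent]

theorem mover_succ (n : ℕ) : mover (n + 1) = (mover n).opponent := by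
  unfold mover
  by_cases h : Even n <;> simp [h, Nat.even_add_one, Player.opponent]

theorem Player.opponent_opponent (P : Player) : P.opponent.opponent = P := by cases P <;> rfl

/-- If a player can avoid losing as second player, with or without an extra element, then the
opponent has no winning strategy. -/
theorem not_hasWinningStrategy_of_survives [Infinite X] (h : ∀ A : Finset X, Survives F A ∅)
    (O : Player) : ¬ HasWinningStrategy F O := by
  classical
  rintro ⟨σ, hσ⟩
  set P := O.opponent with hPdef
  have hOP : O ≠ P := O.ne_opponent
  have hPO : P.opponent = O := O.opponent_opponent
  -- The reply has to be fresh on every list; where survival is not available, any fresh element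
  -- serves.
  have hreply : ∀ l : List X, ∃ y, y ∉ l ∧
      (SurvivesToMove F (ownMoves P l) (ownMoves O l) → (∀ x ∈ l, x ∈ ownMoves P l ∨
        x ∈ ownMoves O l) → Survives F (insert y (ownMoves P l)) (ownMoves O l)) := by
    intro l
    by_cases hl : SurvivesToMove F (ownMoves P l) (ownMoves O l) ∧ ∀ x ∈ l, x ∈ ownMoves P l ∨
        x ∈ ownMoves O l
    · obtain ⟨⟨y, hyP, hyO, hy⟩, hl⟩ := hl
      exact ⟨y, fun hyl => (hl y hyl).elim hyP hyO, fun _ _ => hy⟩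
    · obtain ⟨y, hy⟩ := Infinite.exists_notMem_finset l.toFinset
      exact ⟨y, by simpa using hy, fun h1 h2 => absurd ⟨h1, h2⟩ hl⟩
  choose τ hτl hτ using hreply
  obtain ⟨p, hp⟩ := exists_play fun l => if mover l.length = O then σ.move l else τ l
  have hpO : ∀ n, mover n = O → p n = σ.move (history p n) := by
    intro n hn
    rw [hp n, if_pos (by rwa [length_history])]
  have hpP : ∀ n, mover n = P → p n = τ (history p n) := by
    intro n hn
    rw [hp n, if_neg (by rw [length_history, hn]; exact hOP.symm)]
  have hfresh : ∀ n, p n ∉ history p n := by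
    intro n
    rcases mover_eq_or O n with hn | hn
    · rw [hpO n hn]; exact σ.legal _
    · rw [hpP n hn]; exact hτl _
  have hcover : ∀ n, ∀ x ∈ history p n,
      x ∈ ownMoves P (history p n) ∨ x ∈ ownMoves O (history p n) := by
    intro n x hx
    obtain ⟨i, hi, rfl⟩ := List.mem_map.1 hx
    rw [List.mem_range] at hi
    rw [← Finset.mem_coe, ← Finset.mem_coe, ← claimed_eq_ownMoves, ← claimed_eq_ownMoves]
    rcases mover_eq_or O i with h' | h'
    · exact Or.inr ⟨i, hi, h', rfl⟩
    · exact Or.inl ⟨i, hi, h', rfl⟩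
  have hinv : ∀ n,
      (mover n = O → Survives F (ownMoves P (history p n)) (ownMoves O (history p n))) ∧
      (mover n = P → SurvivesToMove F (ownMoves P (history p n)) (ownMoves O (history p n))) ∧
      (ContainsWinningSet F (ownMoves O (history p n)) →
        ContainsWinningSet F (ownMoves P (history p n))) := by
    intro n
    induction n with
    | zero =>
      have hempty : ∀ Q : Player, ownMoves Q (history p 0) = ∅ := fun Q => rfl
      simp only [hempty]
      refine ⟨fun _ => h ∅, fun _ => ?_, id⟩
      -- If `P` moves first, any opening move will do, since `h` allows an arbitrary extra set.
      obtain ⟨y, -⟩ := Infinite.exists_notMem_finset (∅ : Finset X)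
      exact ⟨y, by simp, by simp, h _⟩
    | succ n ih =>
      obtain ⟨ihO, ihP, ihW⟩ := ih
      rw [history_succ, mover_succ]
      rcases mover_eq_or O n with hn | hn
      · rw [ownMoves_concat_self (P := O) (by rwa [length_history]),
          ownMoves_concat_of_ne (P := P) (by rw [length_history, hn]; exact hOP), hn]
        have hstep := (ihO hn).step (x := p n) (fun hm => hfresh n (mem_of_mem_ownMoves hm))
          (fun hm => hfresh n (mem_of_mem_ownMoves hm))
        exact ⟨fun h' => absurd h'.symm hOP, fun _ => hstep.2, hstep.1⟩
      · rw [ownMoves_concat_self (P := P) (by rwa [length_history]),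
          ownMoves_concat_of_ne (P := O) (by rw [length_history, hn]; exact hOP.symm), hn]
        refine ⟨fun _ => ?_, fun h' => absurd (hPO.symm.trans h') hOP,
          fun h' => (ihW h').mono (Finset.subset_insert _ _)⟩
        rw [hpP n hn]
        exact hτ _ (ihP hn) (hcover n)
  obtain ⟨t, ht, ht'⟩ := hσ p (injective_of_notMem_history hfresh) hpO
  rw [hasWinningSet_iff] at ht ht'
  exact ht' ((hinv t).2.2 ht)

end Survival

/-! ### Copies of the hypergraph -/

/-- The edges of `drawHypergraph` in the order `r, g, a, b, e₁, …, e₅`. -/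
def edge : Fin 9 → Finset (Fin 10) :=
  ![{0, 1, 3, 5, 8}, {0, 2, 4, 7, 9}, {1, 4, 6, 8, 9}, {9, 1, 2, 3, 4}, {1, 2, 3, 4, 5},
    {2, 3, 4, 5, 6}, {3, 4, 5, 6, 7}, {4, 5, 6, 7, 8}, {5, 6, 7, 8, 9}]

theorem card_edge : ∀ i, (edge i).card = 5 := by decide

theorem edge_injective : Function.Injective edge := by decide

theorem drawEdges_eq : drawEdges = Finset.univ.image edge := by decide

/-- The indices of the edges that do not contain the vertex `0` of degree two. -/
def core : Finset (Fin 9) := {2, 3, 4, 5, 6, 7, 8}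

/-- The degree bounds force a vertex that lies in too few claimed edges to be the apex, or to lie
outside the core. -/
theorem three_le_core_degree :
    ∀ v : Fin 10, v ≠ 0 → 3 ≤ (core.filter fun i => v ∈ edge i).card := by decide

theorem four_le_degree :
    ∀ v : Fin 10, v ≠ 0 → 4 ≤ (Finset.univ.filter fun i => v ∈ edge i).card := by decide

theorem zero_mem_edge_iff : ∀ i, (0 : Fin 10) ∈ edge i ↔ i = 0 ∨ i = 1 := by decide

theorem mem_core_iff : ∀ i, i ∈ core ↔ i ≠ 0 ∧ i ≠ 1 := by decide

/-- The edge with index `i` of the copy of the hypergraph given by `θ`. -/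
def copyEdge (θ : Fin 10 ↪ ℕ) (i : Fin 9) : CompleteEdge 5 :=
  ⟨(edge i).map θ, by rw [Finset.card_map, card_edge]⟩

theorem copyEdge_val (θ : Fin 10 ↪ ℕ) (i : Fin 9) : (copyEdge θ i).1 = (edge i).map θ := rfl

theorem copyEdge_injective (θ : Fin 10 ↪ ℕ) : Function.Injective (copyEdge θ) := fun _ _ h =>
  edge_injective (Finset.map_injective θ (congrArg Subtype.val h))

theorem mem_copyEdge {θ : Fin 10 ↪ ℕ} {i : Fin 9} {v : Fin 10} :
    θ v ∈ (copyEdge θ i).1 ↔ v ∈ edge i := by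
  simp [copyEdge]

theorem copyEdge_congr {θ θ' : Fin 10 ↪ ℕ} {i : Fin 9} (h : ∀ v ∈ edge i, θ v = θ' v) :
    copyEdge θ i = copyEdge θ' i := by
  apply Subtype.ext
  ext x
  simp only [copyEdge, Finset.mem_map]
  constructor
  · rintro ⟨v, hv, rfl⟩; exact ⟨v, hv, (h v hv).symm⟩
  · rintro ⟨v, hv, rfl⟩; exact ⟨v, hv, h v hv⟩

theorem containsWinningSet_iff {B : Finset (CompleteEdge 5)} :
    ContainsWinningSet (ramseyWinningSets 5 drawHypergraph) B ↔
      ∃ θ : Fin 10 ↪ ℕ, ∀ i, copyEdge θ i ∈ B := by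
  constructor
  · rintro ⟨W, ⟨f, hf, hW⟩, hWB⟩
    let θ : Fin 10 ↪ ℕ := ⟨f, fun a b hab => hf (Set.mem_univ a) (Set.mem_univ b) hab⟩
    refine ⟨θ, fun i => hWB ?_⟩
    have hmem : ((edge i : Set (Fin 10)).image f) ∈ (drawHypergraph.image f).edgeSet :=
      ⟨_, ⟨edge i, by rw [drawEdges_eq]; simp, rfl⟩, rfl⟩
    rw [← hW] at hmem
    obtain ⟨x, hx, hxi⟩ := hmem
    have : x = copyEdge θ i := by
      apply Subtype.ext
      apply Finset.coe_injective
      rw [copyEdge, Finset.coe_map]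
      exact hxi
    rwa [← this]
  · rintro ⟨θ, hθ⟩
    refine ⟨Finset.univ.image (copyEdge θ), ⟨θ, θ.injective.injOn, ?_⟩, ?_⟩
    · ext s
      constructor
      · rintro ⟨x, hx, rfl⟩
        obtain ⟨i, -, rfl⟩ := Finset.mem_image.1 hx
        exact ⟨edge i, ⟨edge i, by rw [drawEdges_eq]; simp, rfl⟩, by simp [copyEdge]⟩
      · rintro ⟨t, ⟨d, hd, rfl⟩, rfl⟩
        rw [drawEdges_eq] at hd
        obtain ⟨i, -, rfl⟩ := Finset.mem_image.1 hd
        exact ⟨copyEdge θ i, by simp, by simp [copyEdge]⟩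
    · intro x hx
      obtain ⟨i, -, rfl⟩ := Finset.mem_image.1 hx
      exact hθ i

/-! ### Rigidity -/

/-- The sizes of the pairwise intersections of the edges. -/
def interCard : Fin 9 → Fin 9 → ℕ :=
  ![![5, 1, 2, 2, 3, 2, 2, 2, 2], ![1, 5, 2, 3, 2, 2, 2, 2, 2], ![2, 2, 5, 3, 2, 2, 2, 3, 3],
    ![2, 3, 3, 5, 4, 3, 2, 1, 1], ![3, 2, 2, 4, 5, 4, 3, 2, 1], ![2, 2, 2, 3, 4, 5, 4, 3, 2],
    ![2, 2, 2, 2, 3, 4, 5, 4, 3], ![2, 2, 3, 1, 2, 3, 4, 5, 4], ![2, 2, 3, 1, 1, 2, 3, 4, 5]]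

theorem interCard_eq : ∀ i j, interCard i j = (edge i ∩ edge j).card := by decide

/-- The partial index map `q` can be extended by `i ↦ j` without changing the sizes of pairwise
intersections. -/
def preservesInter (q : List (Fin 9 × Fin 9)) (i j : Fin 9) : Bool :=
  q.all fun s => interCard s.1 i == interCard s.2 j

/-- Every extension of the partial index map `q` to all but `b` indices in the list, which
preserves the sizes of pairwise intersections, satisfies `good`. -/
def checkExtensions (good : List (Fin 9 × Fin 9) → Bool) :
    List (Fin 9) → ℕ → List (Fin 9 × Fin 9) → Bool
  | [], _, q => good q
  -- The first conjunct is the branch that omits `i`; it is vacuous once no omission is left.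
  | i :: l, b, q => (b == 0 || checkExtensions good l (b - 1) q) &&
      (List.finRange 9).all fun j => !preservesInter q i j || checkExtensions good l b ((i, j) :: q)

/-- Some triple of edges has an intersection whose size is not preserved by `q`. -/
def breaksTriple (q : List (Fin 9 × Fin 9)) : Bool :=
  q.any fun s => q.any fun t => q.any fun u =>
    (edge s.1 ∩ edge t.1 ∩ edge u.1).card != (edge s.2 ∩ edge t.2 ∩ edge u.2).card

/-- Soundness of the search: omitting the indices outside `K` and sending the others to their values
under `m` is one of its branches, and it ends in the graph of `m` on the listed part of `K`. -/
theorem exists_good_of_checkExtensions {good : List (Fin 9 × Fin 9) → Bool} {m : Fin 9 → Fin 9}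
    {K : Finset (Fin 9)}
    (hm : ∀ i ∈ K, ∀ j ∈ K, interCard i j = interCard (m i) (m j)) :
    ∀ (l : List (Fin 9)) (b : ℕ) (q : List (Fin 9 × Fin 9)), checkExtensions good l b q = true →
      (l.filter fun i => i ∉ K).length ≤ b → (∀ s ∈ q, s.1 ∈ K ∧ s.2 = m s.1) →
      ∃ q', good q' = true ∧ (∀ s ∈ q', s.1 ∈ K ∧ s.2 = m s.1) ∧
        (∀ s ∈ q, s ∈ q') ∧ ∀ i ∈ K, i ∈ l → (i, m i) ∈ q'
  | [], b, q, h, _, hq => ⟨q, h, hq, fun _ hs => hs, by simp⟩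
  | i :: l, b, q, h, hb, hq => by
    rw [checkExtensions, Bool.and_eq_true, Bool.or_eq_true, List.all_eq_true] at h
    by_cases hi : i ∈ K
    · have hext : preservesInter q i (m i) = true := by
        rw [preservesInter, List.all_eq_true]
        intro s hs
        rw [beq_iff_eq, (hq s hs).2]
        exact hm _ (hq s hs).1 _ hi
      have h2 := h.2 (m i) (List.mem_finRange _)
      rw [hext] at h2
      obtain ⟨q', hgood, hq', hsub, hl⟩ := exists_good_of_checkExtensions hm l b ((i, m i) :: q)
        (by simpa using h2) (by simpa [hi] using hb) (by
          intro s hs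
          rcases List.mem_cons.1 hs with rfl | hs
          · exact ⟨hi, rfl⟩
          · exact hq s hs)
      refine ⟨q', hgood, hq', fun s hs => hsub s (List.mem_cons_of_mem _ hs), fun k hk hkl => ?_⟩
      rcases List.mem_cons.1 hkl with rfl | hkl
      · exact hsub _ List.mem_cons_self
      · exact hl k hk hkl
    · have hb' : (l.filter fun i => i ∉ K).length + 1 ≤ b := by simpa [hi] using hb
      have h1 := h.1
      rw [beq_iff_eq] at h1
      obtain ⟨q', hgood, hq', hsub, hl⟩ := exists_good_of_checkExtensions hm l (b - 1) q
        (h1.resolve_left (by omega)) (by omega) hq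
      refine ⟨q', hgood, hq', hsub, fun k hk hkl => ?_⟩
      rcases List.mem_cons.1 hkl with rfl | hkl
      · exact absurd hk hi
      · exact hl k hk hkl

section Rigidity

variable {θ θ' : Fin 10 ↪ ℕ} {K : Finset (Fin 9)}

theorem card_inter_eq_of_copyEdge_eq {m : Fin 9 → Fin 9}
    (h : ∀ i ∈ K, copyEdge θ' i = copyEdge θ (m i)) {i j k : Fin 9} (hi : i ∈ K) (hj : j ∈ K)
    (hk : k ∈ K) :
    (edge i ∩ edge j ∩ edge k).card = (edge (m i) ∩ edge (m j) ∩ edge (m k)).card := by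
  have h' : ∀ i ∈ K, (edge i).map θ' = (edge (m i)).map θ := fun i hi =>
    congrArg Subtype.val (h i hi)
  rw [← Finset.card_map θ', ← Finset.card_map θ, Finset.map_inter, Finset.map_inter,
    Finset.map_inter, Finset.map_inter, h' i hi, h' j hj, h' k hk]

/-- Pairwise intersections prune the search and triple intersections are tested only at its leaves.
Genuine copies preserve both, so the leaf belonging to `m` breaks no triple. -/
theorem exists_good_of_copyEdge_eq {good : List (Fin 9 × Fin 9) → Bool} {m : Fin 9 → Fin 9}
    (h : ∀ i ∈ K, copyEdge θ' i = copyEdge θ (m i)) {l : List (Fin 9)} {b : ℕ}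
    (hgood : checkExtensions (fun q => good q || breaksTriple q) l b [] = true)
    (hb : (l.filter fun i => i ∉ K).length ≤ b) :
    ∃ q, good q = true ∧ ∀ i ∈ K, i ∈ l → (i, m i) ∈ q := by
  have hm : ∀ i ∈ K, ∀ j ∈ K, interCard i j = interCard (m i) (m j) := by
    intro i hi j hj
    have := card_inter_eq_of_copyEdge_eq h hi hj hj
    rwa [Finset.inter_assoc, Finset.inter_assoc, Finset.inter_self, Finset.inter_self,
      ← interCard_eq, ← interCard_eq] at this
  obtain ⟨q, hq, hqK, -, hl⟩ := exists_good_of_checkExtensions hm l b [] hgood hb (by simp)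
  refine ⟨q, (Bool.or_eq_true _ _ ▸ hq).resolve_right fun hbr => ?_, hl⟩
  simp only [breaksTriple, List.any_eq_true, bne_iff_ne] at hbr
  obtain ⟨s, hs, t, ht, u, hu, hne⟩ := hbr
  rw [(hqK s hs).2, (hqK t ht).2, (hqK u hu).2] at hne
  exact hne (card_inter_eq_of_copyEdge_eq h (hqK s hs).1 (hqK t ht).1 (hqK u hu).1)

/-- Two omissions among nine edges leave the seven of `copyEdge_eq_of_seven`. -/
theorem checkExtensions_all : checkExtensions (fun q => (q.all fun s => s.1 == s.2) ||
    breaksTriple q) (List.finRange 9) 2 [] = true := by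
  decide +kernel

/-- One omission among seven core edges leaves six. Index sum 11 is the reflection of the six edges
`b, e₁, …, e₅`; it has no value at index 2, so there `a` is the omitted edge. -/
theorem checkExtensions_core : checkExtensions (fun q => ((q.all fun s => s.1 == s.2) ||
    (q.all fun s => s.1.val + s.2.val == 11)) || breaksTriple q) [2, 3, 4, 5, 6, 7, 8] 1 [] =
      true := by
  decide +kernel

theorem length_filter_finRange (K : Finset (Fin 9)) :
    ((List.finRange 9).filter fun i => i ∉ K).length + K.card = 9 := by
  have h1 : ((List.finRange 9).filter fun i => i ∉ K).toFinset = Kᶜ := by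
    ext i; simp
  have h2 := List.toFinset_card_of_nodup ((List.nodup_finRange 9).filter fun i => i ∉ K)
  have h3 := Finset.card_add_card_compl K
  rw [Fintype.card_fin] at h3
  rw [← h2, h1]
  omega

theorem length_filter_core (hK : K ⊆ core) :
    (([2, 3, 4, 5, 6, 7, 8] : List (Fin 9)).filter fun i => i ∉ K).length + K.card = 7 := by
  have h1 : (([2, 3, 4, 5, 6, 7, 8] : List (Fin 9)).filter fun i => i ∉ K).toFinset =
      core \ K := by
    ext i; simp [core]
  have h2 := List.toFinset_card_of_nodup
    ((show ([2, 3, 4, 5, 6, 7, 8] : List (Fin 9)).Nodup by decide).filter fun i => i ∉ K)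
  have h3 := Finset.card_sdiff_add_card_eq_card hK
  rw [← h2, h1, h3]
  rfl

/-- Two copies with seven common edges have these edges in the same places. -/
theorem copyEdge_eq_of_seven (hK : 7 ≤ K.card)
    (h : ∀ i ∈ K, ∃ j, copyEdge θ' i = copyEdge θ j) : ∀ i ∈ K, copyEdge θ' i = copyEdge θ i := by
  choose! m hm using h
  have hlen := length_filter_finRange K
  obtain ⟨q, hq, hl⟩ := exists_good_of_copyEdge_eq hm checkExtensions_all (by omega)
  intro i hi
  rw [List.all_eq_true] at hq
  have hmi : i = m i := eq_of_beq (hq _ (hl i hi (List.mem_finRange i)))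
  rw [hm i hi, ← hmi]

theorem mem_edge_iff_of_copyEdge_eq {i : Fin 9} (h : copyEdge θ' i = copyEdge θ i)
    {v w : Fin 10} (hvw : θ' v = θ w) : v ∈ edge i ↔ w ∈ edge i := by
  rw [← mem_copyEdge (θ := θ'), h, hvw, mem_copyEdge]

theorem three_le_card_separating : ∀ v w : Fin 10, v ≠ w →
    3 ≤ (Finset.univ.filter fun i => ¬(v ∈ edge i ↔ w ∈ edge i)).card := by decide

/-- A vertex is recognised by the edges through it: at most two edges are missing from `K`, while
any two vertices are separated by three. -/
theorem eq_of_copyEdge_eq (hK : 7 ≤ K.card) (h : ∀ i ∈ K, copyEdge θ' i = copyEdge θ i)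
    {v : Fin 10} {i : Fin 9} (hi : i ∈ K) (hv : v ∈ edge i) : θ' v = θ v := by
  have hmem : θ' v ∈ (copyEdge θ i).1 := by rw [← h i hi]; exact mem_copyEdge.2 hv
  obtain ⟨w, -, hw⟩ := Finset.mem_map.1 hmem
  by_cases hvw : v = w
  · rw [← hw, hvw]
  exfalso
  have hsub : (Finset.univ.filter fun i => ¬(v ∈ edge i ↔ w ∈ edge i)) ⊆ Kᶜ := by
    intro k hk
    rw [Finset.mem_compl]
    intro hkK
    exact (Finset.mem_filter.1 hk).2 (mem_edge_iff_of_copyEdge_eq (h k hkK) hw.symm)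
  have h1 := Finset.card_le_card hsub
  have h2 := Finset.card_add_card_compl K
  rw [Fintype.card_fin] at h2
  have h3 := three_le_card_separating v w hvw
  omega

theorem exists_mem_edge_of_seven (hK : 7 ≤ K.card) {v : Fin 10} (hv : v ≠ 0) :
    ∃ i ∈ K, v ∈ edge i := by
  by_contra hcon
  push Not at hcon
  have hsub : (Finset.univ.filter fun i => v ∈ edge i) ⊆ Kᶜ := by
    intro k hk
    rw [Finset.mem_compl]
    exact fun hkK => hcon k hkK (Finset.mem_filter.1 hk).2
  have h1 := Finset.card_le_card hsub
  have h2 := Finset.card_add_card_compl K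
  rw [Fintype.card_fin] at h2
  have h3 := four_le_degree v hv
  omega

/-- The reflection of the vertices that reverses the cyclic tight path `b, e₁, …, e₅`. -/
def cycleReflection : Equiv.Perm (Fin 10) where
  toFun := ![0, 8, 7, 6, 5, 4, 3, 2, 1, 9]
  invFun := ![0, 8, 7, 6, 5, 4, 3, 2, 1, 9]
  left_inv := by decide
  right_inv := by decide

theorem map_cycleReflection_edge : ∀ i j : Fin 9, i.val + j.val = 11 →
    (edge i).map cycleReflection.toEmbedding = edge j := by decide

theorem copyEdge_trans_perm {τ : Equiv.Perm (Fin 10)} {i j : Fin 9}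
    (h : (edge i).map τ.toEmbedding = edge j) :
    copyEdge (τ.toEmbedding.trans θ) i = copyEdge θ j := by
  apply Subtype.ext
  simp only [copyEdge]
  rw [← h, Finset.map_map]

/-- Two copies, one of which has at least six of its core edges in the other one. -/
theorem copyEdge_eq_of_six_core (hKc : K ⊆ core) (hK : 6 ≤ K.card)
    (h : ∀ i ∈ K, ∃ j, copyEdge θ' i = copyEdge θ j) :
    (∀ i ∈ K, copyEdge θ' i = copyEdge θ i) ∨
      ∀ i ∈ K, copyEdge θ' i = copyEdge (cycleReflection.toEmbedding.trans θ) i ∧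
        ∃ j ∈ core, copyEdge θ' i = copyEdge θ j := by
  choose! m hm using h
  have hlen := length_filter_core hKc
  obtain ⟨q, hq, hl⟩ := exists_good_of_copyEdge_eq hm checkExtensions_core (by omega)
  have hmem : ∀ i ∈ K, i ∈ ([2, 3, 4, 5, 6, 7, 8] : List (Fin 9)) := fun i hi => by
    simpa [core] using hKc hi
  rw [Bool.or_eq_true, List.all_eq_true, List.all_eq_true] at hq
  rcases hq with hq | hq
  · left
    intro i hi
    have hmi : i = m i := eq_of_beq (hq _ (hl i hi (hmem i hi)))
    rw [hm i hi, ← hmi]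
  · right
    intro i hi
    have hs := eq_of_beq (hq _ (hl i hi (hmem i hi)))
    refine ⟨?_, m i, ?_, hm i hi⟩
    · rw [hm i hi, copyEdge_trans_perm (map_cycleReflection_edge _ _ hs)]
    -- Indices are at most 8, so the partner of `i` in the sum 11 is at least 3.
    · have := (mem_core_iff i).1 (hKc hi)
      rw [mem_core_iff]
      simp only at hs
      constructor <;> intro h0 <;> rw [h0] at hs <;> simp at hs <;> omega

/-- Inside the core only `e₃` separates 2 from 3, so these two may be exchanged when `e₃` is the
omitted edge. -/
theorem two_le_card_core_separating : ∀ v w : Fin 10, v ≠ w → v ≠ 0 →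
    ¬(v = 2 ∧ w = 3) → ¬(v = 3 ∧ w = 2) →
    2 ≤ (core.filter fun i => ¬(v ∈ edge i ↔ w ∈ edge i)).card := by decide

/-- Copies with six common core edges agree on their core vertices, except that the vertices `2`
and `3` may be exchanged. -/
theorem eq_of_six_core (hKc : K ⊆ core) (hK : 6 ≤ K.card)
    (h : ∀ i ∈ K, copyEdge θ' i = copyEdge θ i) {v : Fin 10} (hv : v ≠ 0) :
    θ' v = θ v ∨ (v = 2 ∧ θ' v = θ 3) ∨ (v = 3 ∧ θ' v = θ 2) := by
  have hcard : (core \ K).card ≤ 1 := by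
    have := Finset.card_sdiff_add_card_eq_card hKc
    have hc : core.card = 7 := rfl
    omega
  have hex : ∃ i ∈ K, v ∈ edge i := by
    by_contra hcon
    push Not at hcon
    have hsub : (core.filter fun i => v ∈ edge i) ⊆ core \ K := by
      intro k hk
      rw [Finset.mem_filter] at hk
      exact Finset.mem_sdiff.2 ⟨hk.1, fun hkK => hcon k hkK hk.2⟩
    have h1 := Finset.card_le_card hsub
    have h3 := three_le_core_degree v hv
    omega
  obtain ⟨i, hi, hvi⟩ := hex
  have hmem : θ' v ∈ (copyEdge θ i).1 := by rw [← h i hi]; exact mem_copyEdge.2 hvi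
  obtain ⟨w, -, hw⟩ := Finset.mem_map.1 hmem
  by_cases hvw : v = w
  · left; rw [← hw, hvw]
  right
  by_contra hcon
  have h3 := two_le_card_core_separating v w hvw hv
    (fun h' => hcon (Or.inl ⟨h'.1, by rw [← hw, h'.2]⟩))
    (fun h' => hcon (Or.inr ⟨h'.1, by rw [← hw, h'.2]⟩))
  have hsub : (core.filter fun i => ¬(v ∈ edge i ↔ w ∈ edge i)) ⊆ core \ K := by
    intro k hk
    rw [Finset.mem_filter] at hk
    exact Finset.mem_sdiff.2
      ⟨hk.1, fun hkK => hk.2 (mem_edge_iff_of_copyEdge_eq (h k hkK) hw.symm)⟩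
  have h1 := Finset.card_le_card hsub
  omega

end Rigidity

/-! ### The two edges at the apex -/

/-- `s` and `t` are the indices of the two edges through the apex `0`, in some order. -/
def ApexPair (s t : Fin 9) : Prop := (s = 0 ∧ t = 1) ∨ (s = 1 ∧ t = 0)

theorem ApexPair.symm {s t : Fin 9} (h : ApexPair s t) : ApexPair t s := by
  rcases h with ⟨rfl, rfl⟩ | ⟨rfl, rfl⟩
  · exact Or.inr ⟨rfl, rfl⟩
  · exact Or.inl ⟨rfl, rfl⟩

theorem ApexPair.ne {s t : Fin 9} (h : ApexPair s t) : s ≠ t := by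
  rcases h with ⟨rfl, rfl⟩ | ⟨rfl, rfl⟩ <;> decide

theorem ApexPair.zero_mem_left {s t : Fin 9} (h : ApexPair s t) : (0 : Fin 10) ∈ edge s :=
  (zero_mem_edge_iff s).2 (h.imp And.left And.left)

theorem ApexPair.eq_or_eq_or_mem_core {s t : Fin 9} (h : ApexPair s t) (i : Fin 9) :
    i = s ∨ i = t ∨ i ∈ core := by
  rw [mem_core_iff]
  rcases h with ⟨rfl, rfl⟩ | ⟨rfl, rfl⟩ <;> tauto

theorem exists_apexPair {s : Fin 9} (h : (0 : Fin 10) ∈ edge s) : ∃ t, ApexPair s t := by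
  rcases (zero_mem_edge_iff s).1 h with rfl | rfl
  · exact ⟨1, Or.inl ⟨rfl, rfl⟩⟩
  · exact ⟨0, Or.inr ⟨rfl, rfl⟩⟩

theorem zero_notMem_of_mem_core {i : Fin 9} (h : i ∈ core) : (0 : Fin 10) ∉ edge i := by
  rw [zero_mem_edge_iff]
  rw [mem_core_iff] at h
  tauto

/-- The edge with index `s` of the copy `θ` without the apex. -/
def side (θ : Fin 10 ↪ ℕ) (s : Fin 9) : Finset ℕ := ((edge s).erase 0).map θ

theorem copyEdge_val_eq_insert {θ : Fin 10 ↪ ℕ} {s : Fin 9} (h : (0 : Fin 10) ∈ edge s) :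
    (copyEdge θ s).1 = insert (θ 0) (side θ s) := by
  rw [side, ← Finset.map_insert, Finset.insert_erase h]
  rfl

theorem notMem_side {θ : Fin 10 ↪ ℕ} {s : Fin 9} {z : ℕ} (h : ∀ v, v ≠ 0 → θ v ≠ z) :
    z ∉ side θ s := by
  intro hz
  obtain ⟨v, hv, rfl⟩ := Finset.mem_map.1 hz
  exact h v (Finset.ne_of_mem_erase hv) rfl

/-- The copy `θ` with its apex moved to `z`. -/
def moveApex (θ : Fin 10 ↪ ℕ) (z : ℕ) : Fin 10 ↪ ℕ := θ.setValue 0 z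

theorem moveApex_zero (θ : Fin 10 ↪ ℕ) (z : ℕ) : moveApex θ z 0 = z :=
  Function.Embedding.setValue_eq θ 0 z

section MoveApex

variable {θ : Fin 10 ↪ ℕ} {z : ℕ}

theorem moveApex_of_ne (h : ∀ v, v ≠ 0 → θ v ≠ z) {v : Fin 10} (hv : v ≠ 0) :
    moveApex θ z v = θ v := by
  simp [moveApex, Function.Embedding.setValue, hv, h v hv]

theorem moveApex_self (θ : Fin 10 ↪ ℕ) : moveApex θ (θ 0) = θ := by
  ext v
  by_cases hv : v = 0
  · rw [hv, moveApex_zero]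
  · rw [moveApex_of_ne (fun u hu h => hu (θ.injective h)) hv]

theorem copyEdge_moveApex_core (h : ∀ v, v ≠ 0 → θ v ≠ z) {i : Fin 9} (hi : i ∈ core) :
    copyEdge (moveApex θ z) i = copyEdge θ i :=
  copyEdge_congr fun _ hv => moveApex_of_ne h fun h0 => zero_notMem_of_mem_core hi (h0 ▸ hv)

theorem side_moveApex (h : ∀ v, v ≠ 0 → θ v ≠ z) (s : Fin 9) :
    side (moveApex θ z) s = side θ s := by
  ext x
  simp only [side, Finset.mem_map]
  constructor <;> rintro ⟨v, hv, rfl⟩ <;>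
    exact ⟨v, hv, by rw [moveApex_of_ne h (Finset.ne_of_mem_erase hv)]⟩

theorem copyEdge_moveApex_val (h : ∀ v, v ≠ 0 → θ v ≠ z) {s : Fin 9}
    (hs : (0 : Fin 10) ∈ edge s) :
    (copyEdge (moveApex θ z) s).1 = insert z (side θ s) := by
  rw [copyEdge_val_eq_insert hs, moveApex_zero, side_moveApex h]

theorem mem_copyEdge_moveApex {s : Fin 9} (hs : (0 : Fin 10) ∈ edge s) :
    z ∈ (copyEdge (moveApex θ z) s).1 := by
  conv_lhs => rw [← moveApex_zero θ z]
  exact mem_copyEdge.2 hs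

end MoveApex

theorem card_degree_le {θ : Fin 10 ↪ ℕ} {v : Fin 10} {K : Finset (Fin 9)}
    {D : Finset (CompleteEdge 5)} (h : ∀ i ∈ K, v ∈ edge i → copyEdge θ i ∈ D) :
    (K.filter fun i => v ∈ edge i).card ≤ D.card :=
  Finset.card_le_card_of_injOn (copyEdge θ)
    (fun i hi => by
      have hi' := Finset.mem_filter.1 (Finset.mem_coe.1 hi)
      exact h i hi'.1 hi'.2)
    (copyEdge_injective θ).injOn

/-- Two cores within eight edges share at least six edges. -/
theorem exists_common_core {ψ ψ' : Fin 10 ↪ ℕ} {C : Finset (CompleteEdge 5)}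
    (hC : C.card ≤ 8) (h : ∀ i ∈ core, copyEdge ψ i ∈ C) (h' : ∀ i ∈ core, copyEdge ψ' i ∈ C) :
    ∃ K ⊆ core, 6 ≤ K.card ∧ ∀ i ∈ K, ∃ j, copyEdge ψ' i = copyEdge ψ j := by
  refine ⟨core.filter fun i => copyEdge ψ' i ∈ core.image (copyEdge ψ),
    Finset.filter_subset _ _, ?_, fun i hi => by
      obtain ⟨j, -, hj⟩ := Finset.mem_image.1 (Finset.mem_filter.1 hi).2
      exact ⟨j, hj.symm⟩⟩
  have h1 : (core.image (copyEdge ψ)).card = 7 :=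
    Finset.card_image_of_injective _ (copyEdge_injective ψ)
  -- Only one of the eight edges can lie outside the first core, hence at most one edge of the
  -- second core is new.
  have h2 : ((core.filter fun i => ¬ copyEdge ψ' i ∈ core.image (copyEdge ψ)).image
      (copyEdge ψ')).card ≤ (C \ core.image (copyEdge ψ)).card := by
    apply Finset.card_le_card
    intro x hx
    obtain ⟨i, hi, rfl⟩ := Finset.mem_image.1 hx
    rw [Finset.mem_filter] at hi
    exact Finset.mem_sdiff.2 ⟨h' i hi.1, hi.2⟩
  rw [Finset.card_image_of_injective _ (copyEdge_injective ψ')] at h2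
  have h3 := Finset.card_sdiff_add_card_eq_card
    (show core.image (copyEdge ψ) ⊆ C from Finset.image_subset_iff.2 h)
  have h4 := Finset.card_filter_add_card_filter_not (s := core)
    (fun i => copyEdge ψ' i ∈ core.image (copyEdge ψ))
  have h5 : core.card = 7 := rfl
  omega

/-- If two cores within eight edges have disjoint sides, then these are the two sides of the
first core. -/
theorem side_eq_of_disjoint {ψ ψ' : Fin 10 ↪ ℕ} {C : Finset (CompleteEdge 5)} (hC : C.card ≤ 8)
    (h : ∀ i ∈ core, copyEdge ψ i ∈ C) (h' : ∀ i ∈ core, copyEdge ψ' i ∈ C) {s t : Fin 9}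
    (hs : (0 : Fin 10) ∈ edge s) (ht : (0 : Fin 10) ∈ edge t)
    (hdisj : Disjoint (side ψ s) (side ψ' t)) : ApexPair s t ∧ side ψ' t = side ψ t := by
  obtain ⟨K, hKc, hK, hKm⟩ := exists_common_core hC h h'
  have hmem : ∀ {χ : Fin 10 ↪ ℕ} {u : Fin 9} {v : Fin 10}, v ∈ (edge u).erase 0 →
      χ v ∈ side χ u := fun hv => Finset.mem_map_of_mem _ hv
  have hne : ∀ {v w : Fin 10}, v ∈ (edge s).erase 0 → w ∈ (edge t).erase 0 → ψ' w ≠ ψ v :=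
    fun hv hw heq => Finset.disjoint_left.1 hdisj (hmem hv) (heq ▸ hmem hw)
  rcases copyEdge_eq_of_six_core hKc hK hKm with hid | href
  · have hv : ∀ v : Fin 10, v ≠ 0 → v ≠ 2 → v ≠ 3 → ψ' v = ψ v := fun v h0 h2 h3 =>
      (eq_of_six_core hKc hK hid h0).resolve_right
        (by rintro (⟨rfl, -⟩ | ⟨rfl, -⟩) <;> contradiction)
    have hside : ∀ u : Fin 9, (∀ v ∈ (edge u).erase 0, ψ' v = ψ v) → side ψ' u = side ψ u := by
      intro u hu
      ext x
      simp only [side, Finset.mem_map]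
      constructor <;> rintro ⟨v, hv, rfl⟩ <;> exact ⟨v, hv, by rw [hu v hv]⟩
    rcases (zero_mem_edge_iff s).1 hs with rfl | rfl <;>
      rcases (zero_mem_edge_iff t).1 ht with rfl | rfl
    · exact absurd (hv 1 (by decide) (by decide) (by decide)) (hne (by decide) (by decide))
    · refine ⟨Or.inl ⟨rfl, rfl⟩, hside 1 ?_⟩
      -- The exchange would put `ψ 3`, a vertex of the side of `ψ` at index 0, into the disjoint
      -- side of `ψ'`.
      have h2 : ψ' 2 = ψ 2 := by
        rcases eq_of_six_core hKc hK hid (v := 2) (by decide) with h2 | ⟨-, h2⟩ | ⟨h2, -⟩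
        · exact h2
        · exact absurd h2 (hne (by decide) (by decide))
        · exact absurd h2 (by decide)
      intro v hv'
      by_cases hv2 : v = 2
      · rw [hv2, h2]
      · exact hv v (Finset.ne_of_mem_erase hv') hv2 (by rintro rfl; revert hv'; decide)
    · refine ⟨Or.inr ⟨rfl, rfl⟩, hside 0 ?_⟩
      have h3 : ψ' 3 = ψ 3 := by
        rcases eq_of_six_core hKc hK hid (v := 3) (by decide) with h3 | ⟨h3, -⟩ | ⟨-, h3⟩
        · exact h3
        · exact absurd h3 (by decide)
        · exact absurd h3 (hne (by decide) (by decide))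
      intro v hv'
      by_cases hv3 : v = 3
      · rw [hv3, h3]
      · exact hv v (Finset.ne_of_mem_erase hv') (by rintro rfl; revert hv'; decide) hv3
    · exact absurd (hv 4 (by decide) (by decide) (by decide)) (hne (by decide) (by decide))
  · exfalso
    have hv : ∀ v : Fin 10, v ≠ 0 → v ≠ 2 → v ≠ 3 → ψ' v = ψ (cycleReflection v) :=
      fun v h0 h2 h3 => (eq_of_six_core hKc hK (fun i hi => (href i hi).1) h0).resolve_right
        (by rintro (⟨rfl, -⟩ | ⟨rfl, -⟩) <;> contradiction)
    -- In the reflected case the sides always meet: each pair of sides has such a `w` away from the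
    -- ambiguous vertices 2 and 3.
    have key : ∀ w : Fin 10, w ≠ 0 → w ≠ 2 → w ≠ 3 → cycleReflection w ∈ (edge s).erase 0 →
        w ∈ (edge t).erase 0 → False := fun w h0 h2 h3 h4 h5 => hne h4 h5 (hv w h0 h2 h3)
    rcases (zero_mem_edge_iff s).1 hs with rfl | rfl <;>
      rcases (zero_mem_edge_iff t).1 ht with rfl | rfl
    · exact key 8 (by decide) (by decide) (by decide) (by decide) (by decide)
    · exact key 4 (by decide) (by decide) (by decide) (by decide) (by decide)
    · exact key 5 (by decide) (by decide) (by decide) (by decide) (by decide)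
    · exact key 9 (by decide) (by decide) (by decide) (by decide) (by decide)

theorem disjoint_side (φ : Fin 10 ↪ ℕ) {s t : Fin 9} (h : ApexPair s t) :
    Disjoint (side φ s) (side φ t) := by
  rw [side, side, Finset.disjoint_map]
  rcases h with ⟨rfl, rfl⟩ | ⟨rfl, rfl⟩ <;> decide

/-- If all cores in `B` lie within eight edges, then one of the two ways to threaten with the core
`φ` forces replies that are harmless. -/
theorem exists_harmless_side (φ : Fin 10 ↪ ℕ) {B C : Finset (CompleteEdge 5)} (hC : C.card ≤ 8)
    (hBC : ∀ ψ : Fin 10 ↪ ℕ, (∀ i ∈ core, copyEdge ψ i ∈ B) → ∀ i ∈ core, copyEdge ψ i ∈ C) :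
    ∃ s t, ApexPair s t ∧ ∀ ψ : Fin 10 ↪ ℕ, (∀ i ∈ core, copyEdge ψ i ∈ B) →
      ∀ s' t', ApexPair s' t' → side ψ t' = side φ t → side ψ s' = side φ s := by
  by_contra hcon
  push Not at hcon
  -- If both orders fail, `ψ` has one side of `φ` and `ψ'` has the other. These are disjoint, hence
  -- both are sides of `ψ`, contrary to the choice of `ψ`.
  obtain ⟨ψ, hψ, s, t, hst, h1, h2⟩ := hcon 0 1 (Or.inl ⟨rfl, rfl⟩)
  obtain ⟨ψ', hψ', s', t', hst', h1', -⟩ := hcon 1 0 (Or.inr ⟨rfl, rfl⟩)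
  have hdisj : Disjoint (side ψ t) (side ψ' t') := by
    rw [h1, h1']
    exact disjoint_side φ (Or.inr ⟨rfl, rfl⟩)
  obtain ⟨hop, heq⟩ := side_eq_of_disjoint hC (hBC ψ hψ) (hBC ψ' hψ') hst.symm.zero_mem_left
    hst'.symm.zero_mem_left hdisj
  have hts : t' = s := by
    rcases hst with ⟨rfl, rfl⟩ | ⟨rfl, rfl⟩ <;> rcases hop with ⟨h, rfl⟩ | ⟨h, rfl⟩ <;>
      first | rfl | exact absurd h (by decide)
  rw [hts] at heq h1'
  exact h2 (heq.symm.trans h1')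

/-! ### Threatening forever -/

/-- The vertices that are covered by the edges in `B`. -/
def support (B : Finset (CompleteEdge 5)) : Finset ℕ := B.biUnion Subtype.val

theorem mem_support {B : Finset (CompleteEdge 5)} {x : CompleteEdge 5} {z : ℕ} (hx : x ∈ B)
    (hz : z ∈ x.1) : z ∈ support B :=
  Finset.mem_biUnion.2 ⟨x, hx, hz⟩

/-- Whenever all but one of the edges of a copy lie in `B`, the remaining one lies in `A`, and not
in `B`. -/
def Blocks (A B : Finset (CompleteEdge 5)) : Prop :=
  ∀ (θ : Fin 10 ↪ ℕ) (e : Fin 9), (∀ i, i ≠ e → copyEdge θ i ∈ B) →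
    copyEdge θ e ∈ A ∧ copyEdge θ e ∉ B

/-- The edges with index `t` of the copies of `φ` with apices in `Z`. -/
def apexEdges (φ : Fin 10 ↪ ℕ) (t : Fin 9) (Z : Finset ℕ) : Finset (CompleteEdge 5) :=
  Z.image fun z => copyEdge (moveApex φ z) t

theorem mem_apexEdges {φ : Fin 10 ↪ ℕ} {t : Fin 9} {Z : Finset ℕ} {x : CompleteEdge 5} :
    x ∈ apexEdges φ t Z ↔ ∃ z ∈ Z, copyEdge (moveApex φ z) t = x :=
  Finset.mem_image

theorem eq_of_mem_copyEdge_moveApex {φ : Fin 10 ↪ ℕ} {t : Fin 9} {z z' : ℕ}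
    (hz : ∀ v, v ≠ 0 → φ v ≠ z) (hz' : ∀ v, v ≠ 0 → φ v ≠ z') (ht : (0 : Fin 10) ∈ edge t)
    (h : z ∈ (copyEdge (moveApex φ z') t).1) : z = z' := by
  rw [copyEdge_moveApex_val hz' ht, Finset.mem_insert] at h
  exact h.resolve_right (notMem_side hz)

/-- A vertex of `Z` lies in at most two of the opponent's edges, the forced reply and `x`, so a copy
using the reply has its apex there, and `x` is its other apex edge. By harmlessness `x` is then
already in `A'`. A copy using no reply is excluded by `Blocks`. -/
theorem not_copy_of_harmless {φ : Fin 10 ↪ ℕ} {A A' B : Finset (CompleteEdge 5)} {s t : Fin 9}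
    {Z : Finset ℕ} {x : CompleteEdge 5} (hst : ApexPair s t) (hAA' : A ⊆ A') (hB : Blocks A B)
    (hharm : ∀ ψ : Fin 10 ↪ ℕ, (∀ i ∈ core, copyEdge ψ i ∈ B) →
      ∀ s' t', ApexPair s' t' → side ψ t' = side φ t → side ψ s' = side φ s)
    (hZB : ∀ z ∈ Z, z ∉ support B) (hZφ : ∀ z ∈ Z, ∀ v, v ≠ 0 → φ v ≠ z)
    (hZA : ∀ z ∈ Z, copyEdge (moveApex φ z) s ∈ A') (hx : x ∉ A') (θ : Fin 10 ↪ ℕ) :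
    ¬ ∀ i, copyEdge θ i ∈ insert x (B ∪ apexEdges φ t Z) := by
  intro hθ
  have ht0 := hst.symm.zero_mem_left
  have hcases : ∀ i, copyEdge θ i = x ∨ copyEdge θ i ∈ B ∨
      ∃ z ∈ Z, copyEdge θ i = copyEdge (moveApex φ z) t := by
    intro i
    rcases Finset.mem_insert.1 (hθ i) with h | h
    · exact Or.inl h
    · rcases Finset.mem_union.1 h with h | h
      · exact Or.inr (Or.inl h)
      · obtain ⟨z, hz, h⟩ := mem_apexEdges.1 h
        exact Or.inr (Or.inr ⟨z, hz, h.symm⟩)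
  have hat : ∀ z ∈ Z, ∀ j, z ∈ (copyEdge θ j).1 →
      copyEdge θ j = x ∨ copyEdge θ j = copyEdge (moveApex φ z) t := by
    intro z hz j hzj
    rcases hcases j with h | h | ⟨z', hz', h⟩
    · exact Or.inl h
    · exact absurd (mem_support h hzj) (hZB z hz)
    · rw [h] at hzj
      rw [eq_of_mem_copyEdge_moveApex (hZφ z hz) (hZφ z' hz') ht0 hzj]
      exact Or.inr h
  have hapex : ∀ z ∈ Z, ∀ i, copyEdge θ i = copyEdge (moveApex φ z) t → θ 0 = z := by
    intro z hz i hi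
    have hzi : z ∈ (copyEdge θ i).1 := by rw [hi]; exact mem_copyEdge_moveApex ht0
    obtain ⟨v, hv, rfl⟩ := Finset.mem_map.1 hzi
    by_contra hv0
    have hv0 : v ≠ 0 := fun h => hv0 (by rw [h])
    have h1 := four_le_degree v hv0
    have h2 := card_degree_le (θ := θ) (v := v) (K := Finset.univ)
      (D := {x, copyEdge (moveApex φ (θ v)) t}) (by
        intro j _ hj
        simpa using hat _ hz j (mem_copyEdge.2 hj))
    have h3 := Finset.card_le_two (a := x) (b := copyEdge (moveApex φ (θ v)) t)
    omega
  by_cases hex : ∃ i, ∃ z ∈ Z, copyEdge θ i = copyEdge (moveApex φ z) t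
  · obtain ⟨i, z, hz, hi⟩ := hex
    have hθ0 := hapex z hz i hi
    have hi0 : (0 : Fin 10) ∈ edge i := by
      rw [← mem_copyEdge (θ := θ), hθ0, hi]
      exact mem_copyEdge_moveApex ht0
    obtain ⟨j, hij⟩ := exists_apexPair hi0
    have hzj : z ∈ (copyEdge θ j).1 := by
      rw [← hθ0]
      exact mem_copyEdge.2 hij.symm.zero_mem_left
    have hj : copyEdge θ j = x := (hat z hz j hzj).resolve_right fun h =>
      hij.ne (copyEdge_injective θ (hi.trans h.symm))
    have hcore : ∀ k ∈ core, copyEdge θ k ∈ B := by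
      intro k hk
      have hzk : z ∉ (copyEdge θ k).1 := by
        rw [← hθ0, mem_copyEdge]
        exact zero_notMem_of_mem_core hk
      rcases hcases k with h | h | ⟨z', hz', h⟩
      · rw [h, ← hj] at hzk
        exact absurd hzj hzk
      · exact h
      · have hz'0 := hapex z' hz' k h
        rw [← hθ0, hz'0, h] at hzk
        exact absurd (mem_copyEdge_moveApex ht0) hzk
    have hz0 : ∀ v, v ≠ 0 → θ v ≠ z := fun v hv h => hv (θ.injective (h.trans hθ0.symm))
    have hside : side θ i = side φ t := by
      have h1 := congrArg Subtype.val hi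
      rw [copyEdge_val_eq_insert hi0, copyEdge_moveApex_val (hZφ z hz) ht0, hθ0] at h1
      rw [← Finset.erase_insert (notMem_side (s := i) hz0), h1,
        Finset.erase_insert (notMem_side (hZφ z hz))]
    have hside' := hharm θ hcore j i hij.symm hside
    apply hx
    convert hZA z hz
    rw [← hj]
    apply Subtype.ext
    rw [copyEdge_val_eq_insert hij.symm.zero_mem_left, hside', hθ0,
      copyEdge_moveApex_val (hZφ z hz) hst.zero_mem_left]
  · have hxB : ∀ i, copyEdge θ i = x ∨ copyEdge θ i ∈ B := by
      intro i
      rcases hcases i with h | h | ⟨z, hz, h⟩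
      · exact Or.inl h
      · exact Or.inr h
      · exact absurd ⟨i, z, hz, h⟩ hex
    by_cases he : ∃ e, copyEdge θ e = x
    · obtain ⟨e, he⟩ := he
      have := hB θ e fun i hi => (hxB i).resolve_left fun h =>
        hi (copyEdge_injective θ (h.trans he.symm))
      exact hx (hAA' (he ▸ this.1))
    · have hall : ∀ i, copyEdge θ i ∈ B := fun i => (hxB i).resolve_left fun h => he ⟨i, h⟩
      exact (hB θ 0 fun i _ => hall i).2 (hall 0)

/-- A player who owns a core and is to move can draw by threatening forever, provided that the
opponent has no threats and all cores of the opponent lie within eight edges. -/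
theorem survivesToMove_of_core {φ : Fin 10 ↪ ℕ} {A B C : Finset (CompleteEdge 5)}
    (hφ : ∀ i ∈ core, copyEdge φ i ∈ A) (hB : Blocks A B) (hC : C.card ≤ 8)
    (hBC : ∀ ψ : Fin 10 ↪ ℕ, (∀ i ∈ core, copyEdge ψ i ∈ B) → ∀ i ∈ core, copyEdge ψ i ∈ C) :
    SurvivesToMove (ramseyWinningSets 5 drawHypergraph) A B := by
  obtain ⟨s, t, hst, hharm⟩ := exists_harmless_side φ hC hBC
  have hs0 := hst.zero_mem_left
  have ht0 := hst.symm.zero_mem_left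
  -- `Z` collects the apices of answered threats, and `w` is the apex of the pending one.
  let S : Set (Finset (CompleteEdge 5) × Finset (CompleteEdge 5)) :=
    {q | A ⊆ q.1 ∧ ∃ (Z : Finset ℕ) (w : ℕ), q.2 = B ∪ apexEdges φ t Z ∧
      (∀ z ∈ insert w Z, z ∉ support B) ∧ (∀ z ∈ insert w Z, ∀ v, v ≠ 0 → φ v ≠ z) ∧
      (∀ z ∈ insert w Z, copyEdge (moveApex φ z) s ∈ q.1) ∧ w ∉ Z ∧
      copyEdge (moveApex φ w) t ∉ q.1}
  have hfresh : ∀ A' : Finset (CompleteEdge 5), A ⊆ A' → ∀ Z : Finset ℕ,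
      (∀ z ∈ Z, z ∉ support B) → (∀ z ∈ Z, ∀ v, v ≠ 0 → φ v ≠ z) →
      (∀ z ∈ Z, copyEdge (moveApex φ z) s ∈ A') →
      ∃ y, y ∉ A' ∧ y ∉ B ∪ apexEdges φ t Z ∧ (insert y A', B ∪ apexEdges φ t Z) ∈ S := by
    intro A' hA' Z hZB hZφ hZA
    obtain ⟨w, hw⟩ := Infinite.exists_notMem_finset
      (support A' ∪ support (B ∪ apexEdges φ t Z) ∪ Z ∪ Finset.univ.map φ)
    simp only [Finset.mem_union, not_or, Finset.mem_map, Finset.mem_univ, true_and,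
      not_exists] at hw
    obtain ⟨⟨⟨hwA, hwB⟩, hwZ⟩, hwφ⟩ := hw
    have hwB' : w ∉ support B := fun h => hwB (by
      obtain ⟨x, hx, hwx⟩ := Finset.mem_biUnion.1 h
      exact mem_support (Finset.mem_union_left _ hx) hwx)
    have hws : w ∈ (copyEdge (moveApex φ w) s).1 := mem_copyEdge_moveApex hs0
    have hwt : w ∈ (copyEdge (moveApex φ w) t).1 := mem_copyEdge_moveApex ht0
    refine ⟨copyEdge (moveApex φ w) s, fun h => hwA (mem_support h hws),
      fun h => hwB (mem_support h hws), hA'.trans (Finset.subset_insert _ _), Z, w, rfl,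
      ?_, ?_, ?_, hwZ, ?_⟩
    · exact Finset.forall_mem_insert _ _ _ |>.2 ⟨hwB', hZB⟩
    · exact Finset.forall_mem_insert _ _ _ |>.2 ⟨fun v _ => hwφ v, hZφ⟩
    · exact Finset.forall_mem_insert _ _ _ |>.2
        ⟨Finset.mem_insert_self _ _, fun z hz => Finset.mem_insert_of_mem (hZA z hz)⟩
    · rw [Finset.mem_insert, not_or]
      exact ⟨fun h => hst.ne (copyEdge_injective _ h).symm, fun h => hwA (mem_support h hwt)⟩
  have hS : ∀ A' B', (A', B') ∈ S → Survives (ramseyWinningSets 5 drawHypergraph) A' B' := by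
    intro A' B' hmem
    refine Survives.coinduct S ?_ hmem
    rintro A' B' ⟨hA', Z, w, rfl, hZB, hZφ, hZA, hwZ, hwt⟩ x hxA hxB
    dsimp only at hA' hZA hwt hxB ⊢
    have hZ : ∀ z ∈ Z, z ∈ insert w Z := fun z hz => Finset.mem_insert_of_mem hz
    have hwZ' := Finset.mem_insert_self w Z
    refine ⟨fun hcopy => ?_, ?_⟩
    · obtain ⟨θ, hθ⟩ := containsWinningSet_iff.1 hcopy
      exact absurd hθ (not_copy_of_harmless hst hA' hB hharm (fun z hz => hZB z (hZ z hz))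
        (fun z hz => hZφ z (hZ z hz)) (fun z hz => hZA z (hZ z hz)) hxA θ)
    by_cases hx : x = copyEdge (moveApex φ w) t
    · have hins : insert x (B ∪ apexEdges φ t Z) = B ∪ apexEdges φ t (insert w Z) := by
        rw [apexEdges, apexEdges, Finset.image_insert, Finset.union_insert, hx]
      rw [hins]
      obtain ⟨y, hyA, hyB, hy⟩ := hfresh A' hA' (insert w Z) hZB hZφ hZA
      exact ⟨y, hyA, hyB, Or.inl hy⟩
    -- The threat was ignored, so the copy with apex `w` is completed.
    · refine ⟨copyEdge (moveApex φ w) t, hwt, ?_, Or.inr (Survives.of_containsWinningSet ?_)⟩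
      · rw [Finset.mem_insert, Finset.mem_union, not_or, not_or]
        refine ⟨fun h => hx h.symm, fun h => hZB w hwZ' (mem_support h (mem_copyEdge_moveApex ht0)),
          fun h => ?_⟩
        obtain ⟨z, hz, h⟩ := mem_apexEdges.1 h
        have hwz : w ∈ (copyEdge (moveApex φ z) t).1 := by rw [h]; exact mem_copyEdge_moveApex ht0
        rw [eq_of_mem_copyEdge_moveApex (hZφ w hwZ') (hZφ z (hZ z hz)) ht0 hwz] at hwZ
        exact hwZ hz
      · refine containsWinningSet_iff.2 ⟨moveApex φ w, fun i => ?_⟩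
        rcases hst.eq_or_eq_or_mem_core i with rfl | rfl | hi
        · exact Finset.mem_insert_of_mem (hZA w hwZ')
        · exact Finset.mem_insert_self _ _
        · rw [copyEdge_moveApex_core (hZφ w hwZ') hi]
          exact Finset.mem_insert_of_mem (hA' (hφ i hi))
  obtain ⟨y, hyA, hyB, hy⟩ := hfresh A subset_rfl ∅ (by simp) (by simp) (by simp)
  have hempty : B ∪ apexEdges φ t ∅ = B := by simp [apexEdges]
  rw [hempty] at hyB hy
  exact ⟨y, hyA, hyB, hS _ _ hy⟩

/-! ### Blocking the threats of the opponent -/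

theorem nine_le_card_of_copy {B : Finset (CompleteEdge 5)}
    (h : ContainsWinningSet (ramseyWinningSets 5 drawHypergraph) B) : 9 ≤ B.card := by
  obtain ⟨θ, hθ⟩ := containsWinningSet_iff.1 h
  have h1 := Finset.card_image_of_injective Finset.univ (copyEdge_injective θ)
  rw [Finset.card_univ, Fintype.card_fin] at h1
  rw [← h1]
  exact Finset.card_le_card (Finset.image_subset_iff.2 fun i _ => hθ i)

theorem seven_le_card_of_threat {θ : Fin 10 ↪ ℕ} {B : Finset (CompleteEdge 5)}
    {x : CompleteEdge 5} {e : Fin 9} (h : ∀ i, i ≠ e → copyEdge θ i ∈ insert x B) :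
    7 ≤ (Finset.univ.filter fun i => copyEdge θ i ∈ B).card := by
  have h1 : ((Finset.univ.filter fun i => ¬ copyEdge θ i ∈ B).image (copyEdge θ)).card ≤
      ({x, copyEdge θ e} : Finset (CompleteEdge 5)).card := by
    apply Finset.card_le_card
    intro y hy
    obtain ⟨i, hi, rfl⟩ := Finset.mem_image.1 hy
    rw [Finset.mem_insert, Finset.mem_singleton]
    by_cases hie : i = e
    · exact Or.inr (by rw [hie])
    · exact Or.inl ((Finset.mem_insert.1 (h i hie)).resolve_right (Finset.mem_filter.1 hi).2)
  rw [Finset.card_image_of_injective _ (copyEdge_injective θ)] at h1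
  have h2 := Finset.card_le_two (a := x) (b := copyEdge θ e)
  have h3 := Finset.card_filter_add_card_filter_not (s := Finset.univ)
    (fun i => copyEdge θ i ∈ B)
  rw [Finset.card_univ, Fintype.card_fin] at h3
  omega

theorem six_le_card_of_core {ψ : Fin 10 ↪ ℕ} {B : Finset (CompleteEdge 5)}
    {x : CompleteEdge 5} (h : ∀ i ∈ core, copyEdge ψ i ∈ insert x B) :
    6 ≤ (core.filter fun i => copyEdge ψ i ∈ B).card := by
  have h1 : ((core.filter fun i => ¬ copyEdge ψ i ∈ B).image (copyEdge ψ)).card ≤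
      ({x} : Finset (CompleteEdge 5)).card := by
    apply Finset.card_le_card
    intro y hy
    obtain ⟨i, hi, rfl⟩ := Finset.mem_image.1 hy
    rw [Finset.mem_filter] at hi
    rw [Finset.mem_singleton]
    exact (Finset.mem_insert.1 (h i hi.1)).resolve_right hi.2
  rw [Finset.card_image_of_injective _ (copyEdge_injective ψ), Finset.card_singleton] at h1
  have h3 := Finset.card_filter_add_card_filter_not (s := core) (fun i => copyEdge ψ i ∈ B)
  have h4 : core.card = 7 := rfl
  omega

theorem Blocks.not_containsWinningSet {A B : Finset (CompleteEdge 5)} (h : Blocks A B) :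
    ¬ ContainsWinningSet (ramseyWinningSets 5 drawHypergraph) B := by
  intro hB
  obtain ⟨θ, hθ⟩ := containsWinningSet_iff.1 hB
  exact (h θ 0 fun i _ => hθ i).2 (hθ 0)

section Blocking

variable {φ θ : Fin 10 ↪ ℕ} {A B : Finset (CompleteEdge 5)}

/-- One further edge `x` creates no new threat: a threatening copy has seven edges in `B`, so by
rigidity it is `θ` itself, whose missing edge is blocked. -/
theorem blocks_of_core_edge {e : Fin 9} (he : e ∈ core)
    (hB : B = (Finset.univ.erase e).image (copyEdge θ)) (heA : copyEdge θ e ∈ A)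
    {x : CompleteEdge 5} (hx : x ∉ A) : Blocks A (insert x B) := by
  have hmemB : ∀ i, copyEdge θ i ∈ B ↔ i ≠ e := by
    intro i
    rw [hB, (copyEdge_injective θ).mem_finset_image]
    simp
  have heB : copyEdge θ e ∉ insert x B := by
    rw [Finset.mem_insert, not_or, hmemB]
    exact ⟨fun h => hx (h ▸ heA), fun h => h rfl⟩
  intro θ' e' h
  have hK := seven_le_card_of_threat h
  have heq := copyEdge_eq_of_seven (θ := θ) hK fun i hi => by
    have hi := (Finset.mem_filter.1 hi).2
    rw [hB] at hi
    obtain ⟨j, -, hj⟩ := Finset.mem_image.1 hi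
    exact ⟨j, hj.symm⟩
  generalize hKdef : (Finset.univ.filter fun i => copyEdge θ' i ∈ B) = K at hK heq
  have hKB : ∀ i ∈ K, copyEdge θ' i ∈ B := fun i hi => by
    rw [← hKdef] at hi
    exact (Finset.mem_filter.1 hi).2
  have heK : e ∉ K := by
    intro heK
    have := hKB e heK
    rw [heq e heK, hmemB] at this
    exact this rfl
  -- Only six core edges differ from `e`, so `K` contains an apex edge; this pins down the apex too.
  have hzero : ∃ i ∈ K, (0 : Fin 10) ∈ edge i := by
    by_contra hcon
    push Not at hcon
    have hsub : K ⊆ core.erase e := by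
      intro i hi
      refine Finset.mem_erase.2 ⟨fun h => heK (h ▸ hi), (mem_core_iff i).2 ?_⟩
      have := hcon i hi
      rwa [zero_mem_edge_iff, not_or] at this
    have h1 := Finset.card_le_card hsub
    rw [Finset.card_erase_of_mem he] at h1
    have h2 : core.card = 7 := rfl
    omega
  have hθ : ∀ v, θ' v = θ v := by
    intro v
    by_cases hv : v = 0
    · obtain ⟨i, hi, h0⟩ := hzero
      rw [hv]
      exact eq_of_copyEdge_eq hK heq hi h0
    · obtain ⟨i, hi, hvi⟩ := exists_mem_edge_of_seven hK hv
      exact eq_of_copyEdge_eq hK heq hi hvi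
  obtain rfl : θ' = θ := DFunLike.ext _ _ hθ
  obtain rfl : e = e' := by
    by_contra hne
    exact heB (h e hne)
  exact ⟨heA, heB⟩

/-- The opponent has all edges of a copy except for a blocked core edge. -/
theorem survives_of_blocked_core_edge (hφ : ∀ i ∈ core, copyEdge φ i ∈ A) {e : Fin 9}
    (he : e ∈ core) (hB : B = (Finset.univ.erase e).image (copyEdge θ))
    (heA : copyEdge θ e ∈ A) : Survives (ramseyWinningSets 5 drawHypergraph) A B := by
  refine Survives.of_step fun x hxA hxB => ?_
  have hblock := blocks_of_core_edge he hB heA hxA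
  refine ⟨fun h => absurd h hblock.not_containsWinningSet,
    -- A core of the opponent has six edges besides `x`, and by rigidity these are core edges of `θ`
    -- other than `e`.
    survivesToMove_of_core (C := insert x ((core.erase e).image (copyEdge θ))) hφ hblock ?_ ?_⟩
  · have h1 := Finset.card_insert_le x ((core.erase e).image (copyEdge θ))
    rw [Finset.card_image_of_injective _ (copyEdge_injective θ),
      Finset.card_erase_of_mem he] at h1
    have h2 : core.card = 7 := rfl
    omega
  · intro ψ hψ i hi
    rcases Finset.mem_insert.1 (hψ i hi) with h | h
    · exact Finset.mem_insert.2 (Or.inl h)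
    refine Finset.mem_insert_of_mem ?_
    have hK := six_le_card_of_core hψ
    have hiK : i ∈ core.filter fun i => copyEdge ψ i ∈ B := Finset.mem_filter.2 ⟨hi, h⟩
    have hcore : ∃ j ∈ core, copyEdge ψ i = copyEdge θ j := by
      rcases copyEdge_eq_of_six_core (θ := θ) (Finset.filter_subset _ _) hK (fun k hk => by
        have hk := (Finset.mem_filter.1 hk).2
        rw [hB] at hk
        obtain ⟨j, -, hj⟩ := Finset.mem_image.1 hk
        exact ⟨j, hj.symm⟩) with hid | href
      · exact ⟨i, hi, hid i hiK⟩
      · exact (href i hiK).2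
    obtain ⟨j, hj, hij⟩ := hcore
    rw [hij, hB, (copyEdge_injective θ).mem_finset_image] at h
    rw [hij]
    exact Finset.mem_image_of_mem _ (Finset.mem_erase.2 ⟨Finset.ne_of_mem_erase h, hj⟩)

/-- `x` is one of the two edges at the apex `z` of a copy with the core of `θ`, and the other one
has been claimed in `A`. -/
def IsBlockedAt (θ : Fin 10 ↪ ℕ) (A : Finset (CompleteEdge 5)) (x : CompleteEdge 5) (z : ℕ) :
    Prop :=
  ∃ s t, ApexPair s t ∧ (∀ v, v ≠ 0 → θ v ≠ z) ∧ x = copyEdge (moveApex θ z) s ∧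
    copyEdge (moveApex θ z) t ∈ A

theorem IsBlockedAt.mono {A' : Finset (CompleteEdge 5)} {x : CompleteEdge 5} {z : ℕ}
    (h : IsBlockedAt θ A x z) (hA : A ⊆ A') : IsBlockedAt θ A' x z :=
  let ⟨s, t, hst, hz, hx, ht⟩ := h
  ⟨s, t, hst, hz, hx, hA ht⟩

theorem IsBlockedAt.apex_mem {x : CompleteEdge 5} {z : ℕ} (h : IsBlockedAt θ A x z) :
    z ∈ x.1 := by
  obtain ⟨s, t, hst, -, rfl, -⟩ := h
  exact mem_copyEdge_moveApex hst.zero_mem_left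

/-- The opponent owns the core of `θ` and otherwise only blocked edges at apices of this core. -/
structure IsApexPosition (θ : Fin 10 ↪ ℕ) (A B F : Finset (CompleteEdge 5)) : Prop where
  disjoint : Disjoint A B
  eq_union : B = core.image (copyEdge θ) ∪ F
  blocked : ∀ x ∈ F, ∃ z, IsBlockedAt θ A x z

variable {F : Finset (CompleteEdge 5)}

theorem IsApexPosition.eq_of_apex_mem (h : IsApexPosition θ A B F) {x y : CompleteEdge 5} {z : ℕ}
    (hx : IsBlockedAt θ A x z) (hy : y ∈ B) (hz : z ∈ y.1) : y = x := by
  obtain ⟨s, t, hst, hzθ, rfl, ht⟩ := hx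
  have hyB := hy
  rw [h.eq_union, Finset.mem_union] at hy
  rcases hy with hy | hy
  · obtain ⟨i, hi, rfl⟩ := Finset.mem_image.1 hy
    obtain ⟨v, hv, hvz⟩ := Finset.mem_map.1 hz
    exact absurd hvz (hzθ v fun h0 => zero_notMem_of_mem_core hi (h0 ▸ hv))
  · obtain ⟨z', s', t', hst', hzθ', rfl, -⟩ := h.blocked y hy
    obtain rfl := eq_of_mem_copyEdge_moveApex hzθ hzθ' hst'.zero_mem_left hz
    rcases hst.eq_or_eq_or_mem_core s' with rfl | rfl | hs'
    · rfl
    · exact absurd hyB (Finset.disjoint_left.1 h.disjoint ht)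
    · exact absurd hst'.zero_mem_left (zero_notMem_of_mem_core hs')

/-- Every threat of the opponent in such a position is made at a new apex. -/
theorem IsApexPosition.threat (h : IsApexPosition θ A B F) {x : CompleteEdge 5} (hx : x ∉ A)
    {θ' : Fin 10 ↪ ℕ} {e : Fin 9} (hθ' : ∀ i, i ≠ e → copyEdge θ' i ∈ insert x B) :
    copyEdge θ' e ∈ A ∨ (copyEdge θ' e ∉ insert x B ∧
      ∃ w s t, ApexPair s t ∧ (∀ v, v ≠ 0 → θ v ≠ w) ∧ x = copyEdge (moveApex θ w) s ∧
        copyEdge θ' e = copyEdge (moveApex θ w) t) := by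
  have hK := seven_le_card_of_threat hθ'
  generalize hKdef : (Finset.univ.filter fun i => copyEdge θ' i ∈ B) = K at hK
  have hKB : ∀ i, i ∈ K ↔ copyEdge θ' i ∈ B := fun i => by rw [← hKdef]; simp
  have hapex : ∀ i z, IsBlockedAt θ A (copyEdge θ' i) z → θ' 0 = z := by
    intro i z hi
    obtain ⟨v, hv, rfl⟩ := Finset.mem_map.1 hi.apex_mem
    by_contra hv0
    have hv0 : v ≠ 0 := fun h => hv0 (by rw [h])
    have h1 := four_le_degree v hv0
    have h2 := card_degree_le (θ := θ') (v := v) (K := Finset.univ)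
      (D := {x, copyEdge θ' i, copyEdge θ' e}) (by
        intro j _ hj
        simp only [Finset.mem_insert, Finset.mem_singleton]
        by_cases hje : j = e
        · exact Or.inr (Or.inr (by rw [hje]))
        · rcases Finset.mem_insert.1 (hθ' j hje) with hjx | hjB
          · exact Or.inl hjx
          · exact Or.inr (Or.inl (h.eq_of_apex_mem hi hjB (mem_copyEdge.2 hj))))
    have h3 := Finset.card_le_three (a := x) (b := copyEdge θ' i) (c := copyEdge θ' e)
    omega
  have hcases : ∀ i ∈ K, (∃ j ∈ core, copyEdge θ' i = copyEdge θ j) ∨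
      ∃ z, IsBlockedAt θ A (copyEdge θ' i) z := by
    intro i hi
    rw [hKB, h.eq_union, Finset.mem_union] at hi
    rcases hi with hi | hi
    · obtain ⟨j, hj, hij⟩ := Finset.mem_image.1 hi
      exact Or.inl ⟨j, hj, hij.symm⟩
    · exact Or.inr (h.blocked _ hi)
  -- A blocked apex edge in the threat fixes its apex, and the missing edge is the blocking one.
  -- Otherwise the seven old edges are exactly the core, and `x` is an apex edge.
  by_cases hex : ∃ i ∈ K, ∃ z, IsBlockedAt θ A (copyEdge θ' i) z
  · left
    obtain ⟨i, hi, z, hiz⟩ := hex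
    have hz := hapex i z hiz
    obtain ⟨s, t, hst, hzθ, his, htA⟩ := hiz
    have heq := copyEdge_eq_of_seven (θ := moveApex θ z) hK fun k hk => by
      rcases hcases k hk with ⟨j, hj, hkj⟩ | ⟨z', hkz⟩
      · exact ⟨j, by rw [hkj, copyEdge_moveApex_core hzθ hj]⟩
      · obtain rfl : z = z' := hz.symm.trans (hapex k z' hkz)
        obtain ⟨s', -, -, -, hks, -⟩ := hkz
        exact ⟨s', hks⟩
    have hθ : θ' = moveApex θ z := by
      apply DFunLike.ext
      intro v
      by_cases hv : v = 0
      · rw [hv, hz, moveApex_zero]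
      · obtain ⟨k, hk, hvk⟩ := exists_mem_edge_of_seven hK hv
        exact eq_of_copyEdge_eq hK heq hk hvk
    rw [← hθ] at htA
    have hte : t = e := by
      by_contra hte
      rcases Finset.mem_insert.1 (hθ' t hte) with h' | h'
      · exact hx (h' ▸ htA)
      · exact Finset.disjoint_left.1 h.disjoint htA h'
    rwa [← hte]
  · have hcore : ∀ i ∈ K, ∃ j ∈ core, copyEdge θ' i = copyEdge θ j := fun i hi =>
      (hcases i hi).resolve_right fun h' => hex ⟨i, hi, h'⟩
    have heq := copyEdge_eq_of_seven (θ := θ) hK fun i hi =>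
      let ⟨j, _, hj⟩ := hcore i hi
      ⟨j, hj⟩
    have hKcore : K = core := by
      apply Finset.eq_of_subset_of_card_le
      · intro i hi
        obtain ⟨j, hj, hij⟩ := hcore i hi
        rwa [copyEdge_injective θ ((heq i hi).symm.trans hij)]
      · exact hK
    have hv : ∀ v, v ≠ 0 → θ' v = θ v := fun v hv0 =>
      let ⟨k, hk, hvk⟩ := exists_mem_edge_of_seven hK hv0
      eq_of_copyEdge_eq hK heq hk hvk
    have hwθ : ∀ v, v ≠ 0 → θ v ≠ θ' 0 := fun v hv0 h' =>
      hv0 (θ'.injective ((hv v hv0).trans h'))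
    have hθ : θ' = moveApex θ (θ' 0) := by
      apply DFunLike.ext
      intro v
      by_cases hv0 : v = 0
      · rw [hv0, moveApex_zero]
      · rw [moveApex_of_ne hwθ hv0, hv v hv0]
    have hapexx : ∀ s, (0 : Fin 10) ∈ edge s → s ≠ e → copyEdge θ' s = x := by
      intro s hs hse
      refine (Finset.mem_insert.1 (hθ' s hse)).resolve_right fun hsB => ?_
      rw [← hKB, hKcore] at hsB
      exact zero_notMem_of_mem_core hsB hs
    have he0 : (0 : Fin 10) ∈ edge e := by
      by_contra he0
      have h0 := hapexx 0 (by decide) (by rintro rfl; exact he0 (by decide))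
      have h1 := hapexx 1 (by decide) (by rintro rfl; exact he0 (by decide))
      exact absurd (copyEdge_injective θ' (h0.trans h1.symm)) (by decide)
    obtain ⟨s, hes⟩ := exists_apexPair he0
    have hs := hapexx s hes.symm.zero_mem_left hes.symm.ne
    right
    refine ⟨?_, θ' 0, s, e, hes.symm, hwθ, ?_, ?_⟩
    · rw [Finset.mem_insert, not_or, ← hKB, hKcore, ← hs]
      exact ⟨fun h' => hes.ne (copyEdge_injective θ' h'),
        fun h' => zero_notMem_of_mem_core h' he0⟩
    · rw [← hθ, hs]
    · rw [← hθ]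

/-- A blocked apex edge contains an apex lying in no other edge of `B`. With `x` this gives degree
at most two, too little for a core vertex. -/
theorem IsApexPosition.core_subset (h : IsApexPosition θ A B F) {x : CompleteEdge 5}
    {ψ : Fin 10 ↪ ℕ} (hψ : ∀ i ∈ core, copyEdge ψ i ∈ insert x B) :
    ∀ i ∈ core, copyEdge ψ i ∈ insert x (core.image (copyEdge θ)) := by
  intro i hi
  rcases Finset.mem_insert.1 (hψ i hi) with hix | hiB
  · exact Finset.mem_insert.2 (Or.inl hix)
  rw [h.eq_union, Finset.mem_union] at hiB
  rcases hiB with hiB | hiF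
  · exact Finset.mem_insert_of_mem hiB
  exfalso
  obtain ⟨z, hz⟩ := h.blocked _ hiF
  obtain ⟨v, hv, rfl⟩ := Finset.mem_map.1 hz.apex_mem
  have h1 := three_le_core_degree v fun h0 => zero_notMem_of_mem_core hi (h0 ▸ hv)
  have h2 := card_degree_le (θ := ψ) (v := v) (K := core) (D := {x, copyEdge ψ i}) (by
    intro j hj hvj
    rw [Finset.mem_insert, Finset.mem_singleton]
    rcases Finset.mem_insert.1 (hψ j hj) with hjx | hjB
    · exact Or.inl hjx
    · exact Or.inr (h.eq_of_apex_mem hz hjB (mem_copyEdge.2 hvj)))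
  have h3 := Finset.card_le_two (a := x) (b := copyEdge ψ i)
  omega

/-- Blocking a new threat leads to a position of the same kind, possibly forever; after a move
without an open threat the player starts forcing. -/
theorem IsApexPosition.survives (h : IsApexPosition θ A B F)
    (hφ : ∀ i ∈ core, copyEdge φ i ∈ A) :
    Survives (ramseyWinningSets 5 drawHypergraph) A B := by
  refine Survives.coinduct
    {q | (∀ i ∈ core, copyEdge φ i ∈ q.1) ∧ ∃ F, IsApexPosition θ q.1 q.2 F} ?_ ⟨hφ, F, h⟩
  rintro A B ⟨hφ, F, h⟩ x hxA hxB
  dsimp only at hφ h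
  have hdisj : Disjoint A (insert x B) := Finset.disjoint_insert_right.2 ⟨hxA, h.disjoint⟩
  refine ⟨fun hcopy => ?_, ?_⟩
  · obtain ⟨θ', hθ'⟩ := containsWinningSet_iff.1 hcopy
    rcases h.threat hxA (e := 0) fun i _ => hθ' i with h' | ⟨h', -⟩
    · exact absurd (hθ' 0) (Finset.disjoint_left.1 hdisj h')
    · exact absurd (hθ' 0) h'
  by_cases hthreat : ∃ (θ' : Fin 10 ↪ ℕ) (e : Fin 9),
      (∀ i, i ≠ e → copyEdge θ' i ∈ insert x B) ∧ copyEdge θ' e ∉ A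
  · obtain ⟨θ', e, hθ', he⟩ := hthreat
    obtain ⟨heB, w, s, t, hst, hw, hxs, het⟩ := (h.threat hxA hθ').resolve_left he
    refine ⟨copyEdge θ' e, he, heB, Or.inl ⟨fun i hi => Finset.mem_insert_of_mem (hφ i hi),
      insert x F, Finset.disjoint_insert_left.2 ⟨heB, hdisj⟩, ?_, ?_⟩⟩
    · dsimp only
      rw [h.eq_union, Finset.union_insert]
    · refine (Finset.forall_mem_insert _ _ _).2 ⟨⟨w, s, t, hst, hw, hxs, ?_⟩, fun y hy => ?_⟩
      · rw [← het]
        exact Finset.mem_insert_self _ _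
      · obtain ⟨z, hz⟩ := h.blocked y hy
        exact ⟨z, hz.mono (Finset.subset_insert _ _)⟩
  · push Not at hthreat
    have hblock : Blocks A (insert x B) := fun θ' e hθ' =>
      ⟨hthreat θ' e hθ', Finset.disjoint_left.1 hdisj (hthreat θ' e hθ')⟩
    obtain ⟨y, hyA, hyB, hy⟩ := survivesToMove_of_core
      (C := insert x (core.image (copyEdge θ))) hφ hblock (by
        have h1 := Finset.card_insert_le x (core.image (copyEdge θ))
        rw [Finset.card_image_of_injective _ (copyEdge_injective θ)] at h1
        exact h1) (fun ψ hψ => h.core_subset hψ)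
    exact ⟨y, hyA, hyB, Or.inr hy⟩

/-- A player who owns a core when the opponent owns only seven edges does not lose. -/
theorem survives_of_core (hφ : ∀ i ∈ core, copyEdge φ i ∈ A) (hdisj : Disjoint A B)
    (hcard : B.card = 7) : Survives (ramseyWinningSets 5 drawHypergraph) A B := by
  refine Survives.of_step fun x hxA hxB => ?_
  have hdisj' : Disjoint A (insert x B) := Finset.disjoint_insert_right.2 ⟨hxA, hdisj⟩
  have hcard' : (insert x B).card = 8 := by rw [Finset.card_insert_of_notMem hxB, hcard]
  have hcopy : ¬ ContainsWinningSet (ramseyWinningSets 5 drawHypergraph) (insert x B) := by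
    intro h
    have := nine_le_card_of_copy h
    omega
  refine ⟨fun h => absurd h hcopy, ?_⟩
  by_cases hthreat : ∃ (θ : Fin 10 ↪ ℕ) (e : Fin 9),
      (∀ i, i ≠ e → copyEdge θ i ∈ insert x B) ∧ copyEdge θ e ∉ A
  · obtain ⟨θ, e, hθ, heA⟩ := hthreat
    have heB : copyEdge θ e ∉ insert x B := by
      intro heB
      refine hcopy (containsWinningSet_iff.2 ⟨θ, fun i => ?_⟩)
      by_cases hi : i = e
      · rwa [hi]
      · exact hθ i hi
    -- The opponent has exactly eight edges, so the threat uses all of them.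
    have hB : insert x B = (Finset.univ.erase e).image (copyEdge θ) := by
      symm
      apply Finset.eq_of_subset_of_card_le
      · exact Finset.image_subset_iff.2 fun i hi => hθ i (Finset.ne_of_mem_erase hi)
      · rw [Finset.card_image_of_injective _ (copyEdge_injective θ),
          Finset.card_erase_of_mem (Finset.mem_univ e), hcard']
        simp
    have hφ' : ∀ i ∈ core, copyEdge φ i ∈ insert (copyEdge θ e) A := fun i hi =>
      Finset.mem_insert_of_mem (hφ i hi)
    refine ⟨copyEdge θ e, heA, heB, ?_⟩
    by_cases hec : e ∈ core
    · exact survives_of_blocked_core_edge hφ' hec hB (Finset.mem_insert_self _ _)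
    · have he0 : (0 : Fin 10) ∈ edge e := by
        rw [zero_mem_edge_iff]
        rw [mem_core_iff] at hec
        tauto
      obtain ⟨s, hes⟩ := exists_apexPair he0
      refine IsApexPosition.survives (θ := θ) (F := {copyEdge θ s})
        ⟨Finset.disjoint_insert_left.2 ⟨heB, hdisj'⟩, ?_, ?_⟩ hφ'
      · rw [hB, ← Finset.image_singleton, ← Finset.image_union]
        congr 1
        ext i
        rw [Finset.mem_erase, Finset.mem_union, Finset.mem_singleton]
        constructor
        · rintro ⟨hi, -⟩
          rcases hes.eq_or_eq_or_mem_core i with h | h | h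
          · exact absurd h hi
          · exact Or.inr h
          · exact Or.inl h
        · rintro (h | rfl)
          · exact ⟨fun h' => hec (h' ▸ h), Finset.mem_univ _⟩
          · exact ⟨hes.symm.ne, Finset.mem_univ _⟩
      · intro y hy
        rw [Finset.mem_singleton] at hy
        refine ⟨θ 0, s, e, hes.symm, fun v hv h => hv (θ.injective h), ?_, ?_⟩
        · rw [moveApex_self, hy]
        · rw [moveApex_self]
          exact Finset.mem_insert_self _ _
  · push Not at hthreat
    exact survivesToMove_of_core (C := insert x B) hφ
      (fun θ e hθ => ⟨hthreat θ e hθ, Finset.disjoint_left.1 hdisj' (hthreat θ e hθ)⟩)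
      hcard'.le (fun ψ hψ => hψ)

end Blocking

/-! ### Building a core in seven moves -/

section Building

variable {φ : Fin 10 ↪ ℕ} {A B : Finset (CompleteEdge 5)}

/-- The reflection permutes `b, e₁, …, e₅` but moves `a`, so two different edges complete a core and
the opponent can take only one. -/
theorem survives_of_two_options (hA : ∀ i : Fin 9, 3 ≤ i → copyEdge φ i ∈ A)
    (hdisj : Disjoint A B) (hcard : B.card = 6)
    (h : copyEdge φ 2 ∉ A ∧ copyEdge φ 2 ∉ B)
    (h' : copyEdge (cycleReflection.toEmbedding.trans φ) 2 ∉ A ∧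
      copyEdge (cycleReflection.toEmbedding.trans φ) 2 ∉ B) :
    Survives (ramseyWinningSets 5 drawHypergraph) A B := by
  refine Survives.of_step fun x hxA hxB => ?_
  have hcard' : (insert x B).card = 7 := by rw [Finset.card_insert_of_notMem hxB, hcard]
  refine ⟨fun hcopy => ?_, ?_⟩
  · have := nine_le_card_of_copy hcopy
    omega
  have hplay : ∀ χ : Fin 10 ↪ ℕ, (∀ i : Fin 9, 3 ≤ i → copyEdge χ i ∈ A) →
      (copyEdge χ 2 ∉ A ∧ copyEdge χ 2 ∉ B) → x ≠ copyEdge χ 2 →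
      SurvivesToMove (ramseyWinningSets 5 drawHypergraph) A (insert x B) := by
    intro χ hχ h2 hx
    have h2B : copyEdge χ 2 ∉ insert x B := by
      rw [Finset.mem_insert, not_or]
      exact ⟨hx.symm, h2.2⟩
    refine ⟨copyEdge χ 2, h2.1, h2B, survives_of_core (φ := χ) ?_
      (Finset.disjoint_insert_left.2 ⟨h2B, Finset.disjoint_insert_right.2 ⟨hxA, hdisj⟩⟩) hcard'⟩
    intro i hi
    rcases (show ∀ i ∈ core, i = 2 ∨ 3 ≤ i by decide) i hi with rfl | hi
    · exact Finset.mem_insert_self _ _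
    · exact Finset.mem_insert_of_mem (hχ i hi)
  by_cases hx : x = copyEdge φ 2
  · refine hplay (cycleReflection.toEmbedding.trans φ) (fun i hi => ?_) h' ?_
    · obtain ⟨j, hj, hij⟩ := (show ∀ i : Fin 9, 3 ≤ i → ∃ j : Fin 9, 3 ≤ j ∧
        i.val + j.val = 11 by decide) i hi
      rw [copyEdge_trans_perm (map_cycleReflection_edge i j hij)]
      exact hA j hj
    · rw [hx]
      intro heq
      have h1 := congrArg Subtype.val heq
      rw [copyEdge_val, copyEdge_val, ← Finset.map_map] at h1
      exact absurd (Finset.map_injective φ h1) (by decide)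
  · exact hplay φ hA h hx

theorem survivesToMove_of_closing (hA : ∀ i : Fin 9, 4 ≤ i → copyEdge φ i ∈ A)
    (hdisj : Disjoint A B) (hcard : B.card = 6)
    (h2 : copyEdge φ 2 ∉ A ∧ copyEdge φ 2 ∉ B) (h3 : copyEdge φ 3 ∉ A ∧ copyEdge φ 3 ∉ B)
    (h2' : copyEdge (cycleReflection.toEmbedding.trans φ) 2 ∉ A ∧
      copyEdge (cycleReflection.toEmbedding.trans φ) 2 ∉ B) :
    SurvivesToMove (ramseyWinningSets 5 drawHypergraph) A B := by
  refine ⟨copyEdge φ 3, h3.1, h3.2, survives_of_two_options (φ := φ) ?_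
    (Finset.disjoint_insert_left.2 ⟨h3.2, hdisj⟩) hcard ⟨?_, h2.2⟩ ⟨?_, h2'.2⟩⟩
  · intro i hi
    rcases (show ∀ i : Fin 9, 3 ≤ i → i = 3 ∨ 4 ≤ i by decide) i hi with rfl | hi
    · exact Finset.mem_insert_self _ _
    · exact Finset.mem_insert_of_mem (hA i hi)
  · rw [Finset.mem_insert, not_or]
    exact ⟨fun h => absurd (copyEdge_injective φ h) (by decide), h2.1⟩
  · rw [Finset.mem_insert, not_or]
    refine ⟨fun h => ?_, h2'.1⟩
    -- Seen from the reflected copy, `b` is `e₅`, so injectivity of that copy separates it from the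
    -- reflected `a`.
    rw [← copyEdge_trans_perm (map_cycleReflection_edge 8 3 rfl)] at h
    exact absurd (copyEdge_injective _ h) (by decide)

/-- The reversal of the tight path `e₁, …, e₅`. -/
def pathReversal : Equiv.Perm (Fin 10) where
  toFun := ![0, 9, 8, 7, 6, 5, 4, 3, 2, 1]
  invFun := ![0, 9, 8, 7, 6, 5, 4, 3, 2, 1]
  left_inv := by decide
  right_inv := by decide

theorem map_pathReversal_edge : ∀ i j : Fin 9, i.val + j.val = 12 →
    (edge i).map pathReversal.toEmbedding = edge j := by decide

/-- The edges that are needed to continue from the tight path `e₁, …, e₅` to a core by way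
of `b`. -/
def closingOptions : Finset (Finset (Fin 10)) := {edge 2, edge 3, {1, 3, 5, 8, 9}}

/-- A player who owns a tight path with five edges, no edge of the board being claimed that
contains both ends of the path, can continue to a core. -/
theorem survives_of_path (hA : ∀ i : Fin 9, 4 ≤ i → copyEdge φ i ∈ A) (hdisj : Disjoint A B)
    (hcard : B.card = 5) (hends : ∀ x ∈ A ∪ B, ¬ (φ 1 ∈ x.1 ∧ φ 9 ∈ x.1)) :
    Survives (ramseyWinningSets 5 drawHypergraph) A B := by
  refine Survives.of_step fun x hxA hxB => ?_
  have hcard' : (insert x B).card = 6 := by rw [Finset.card_insert_of_notMem hxB, hcard]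
  refine ⟨fun hcopy => ?_, ?_⟩
  · have := nine_le_card_of_copy hcopy
    omega
  have hdisj' : Disjoint A (insert x B) := Finset.disjoint_insert_right.2 ⟨hxA, hdisj⟩
  have hfree : ∀ (χ : Fin 10 ↪ ℕ) (i : Fin 9) (d : Finset (Fin 10)),
      (copyEdge χ i).1 = d.map φ → 1 ∈ d ∧ 9 ∈ d → x.1 ≠ d.map φ →
      copyEdge χ i ∉ A ∧ copyEdge χ i ∉ insert x B := by
    intro χ i d hval hd hx
    have hnot : copyEdge χ i ∉ A ∪ B := fun hmem =>
      hends _ hmem (by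
        rw [hval]
        exact ⟨Finset.mem_map_of_mem _ hd.1, Finset.mem_map_of_mem _ hd.2⟩)
    rw [Finset.mem_union, not_or] at hnot
    refine ⟨hnot.1, ?_⟩
    rw [Finset.mem_insert, not_or]
    exact ⟨fun h => hx (by rw [← hval, h]), hnot.2⟩
  by_cases hx : ∃ d ∈ closingOptions, x.1 = d.map φ
  · obtain ⟨d, hd, hxd⟩ := hx
    have hne : ∀ d' : Finset (Fin 10), d' ∉ closingOptions → x.1 ≠ d'.map φ := by
      intro d' hd' h
      rw [hxd] at h
      exact hd' (Finset.map_injective φ h ▸ hd)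
    -- The reversed path needs three edges outside `closingOptions`. They also contain both ends of
    -- the path, so all three are free.
    refine survivesToMove_of_closing (φ := pathReversal.toEmbedding.trans φ) ?_ hdisj' hcard'
      (hfree _ 2 {1, 2, 4, 6, 9} ?_ (by decide) (hne _ (by decide)))
      (hfree _ 3 {1, 6, 7, 8, 9} ?_ (by decide) (hne _ (by decide)))
      (hfree _ 2 {1, 2, 5, 7, 9} ?_ (by decide) (hne _ (by decide)))
    · intro i hi
      obtain ⟨j, hj, hij⟩ := (show ∀ i : Fin 9, 4 ≤ i → ∃ j : Fin 9, 4 ≤ j ∧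
        i.val + j.val = 12 by decide) i hi
      rw [copyEdge_trans_perm (map_pathReversal_edge i j hij)]
      exact hA j hj
    · rw [copyEdge_val, ← Finset.map_map,
        show (edge 2).map pathReversal.toEmbedding = {1, 2, 4, 6, 9} by decide]
    · rw [copyEdge_val, ← Finset.map_map,
        show (edge 3).map pathReversal.toEmbedding = {1, 6, 7, 8, 9} by decide]
    · rw [copyEdge_val, ← Finset.map_map, ← Finset.map_map,
        show ((edge 2).map cycleReflection.toEmbedding).map pathReversal.toEmbedding =
          {1, 2, 5, 7, 9} by decide]
  · have hne : ∀ d' ∈ closingOptions, x.1 ≠ d'.map φ := fun d' hd' h => hx ⟨d', hd', h⟩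
    refine survivesToMove_of_closing (φ := φ) hA hdisj' hcard'
      (hfree φ 2 (edge 2) rfl (by decide) (hne _ (by decide)))
      (hfree φ 3 (edge 3) rfl (by decide) (hne _ (by decide)))
      (hfree _ 2 {1, 3, 5, 8, 9} ?_ (by decide) (hne _ (by decide)))
    rw [copyEdge_val, ← Finset.map_map,
      show (edge 2).map cycleReflection.toEmbedding = {1, 3, 5, 8, 9} by decide]

/-- A tight path can always be extended by an edge with a fresh vertex. -/
theorem survives_of_extension {k : ℕ} {v : Fin 10} {i : Fin 9} (hi : i.val = k + 4)
    (hvi : v ∈ edge i) (hv : ∀ j : Fin 9, 4 ≤ j → j < i → v ∉ edge j)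
    (hA : ∀ j : Fin 9, 4 ≤ j → j < i → copyEdge φ j ∈ A) (hdisj : Disjoint A B)
    (hcard : B.card = k)
    (hnext : ∀ (χ : Fin 10 ↪ ℕ) (A' B' : Finset (CompleteEdge 5)), Disjoint A' B' →
      B'.card = k + 1 → (∀ j : Fin 9, 4 ≤ j → j ≤ i → copyEdge χ j ∈ A') →
      (∀ x ∈ A' ∪ B', χ v ∈ x.1 → x = copyEdge χ i) →
      Survives (ramseyWinningSets 5 drawHypergraph) A' B') :
    Survives (ramseyWinningSets 5 drawHypergraph) A B := by
  refine Survives.of_step fun x hxA hxB => ?_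
  have hcard' : (insert x B).card = k + 1 := by rw [Finset.card_insert_of_notMem hxB, hcard]
  refine ⟨fun hcopy => ?_, ?_⟩
  · have := nine_le_card_of_copy hcopy
    omega
  obtain ⟨w, hw⟩ := Infinite.exists_notMem_finset (support (A ∪ insert x B) ∪ Finset.univ.map φ)
  simp only [Finset.mem_union, not_or, Finset.mem_map, Finset.mem_univ, true_and,
    not_exists] at hw
  obtain ⟨hwS, hwφ⟩ := hw
  let χ : Fin 10 ↪ ℕ := φ.setValue v w
  have hχv : χ v = w := Function.Embedding.setValue_eq φ v w
  have hχ : ∀ u, u ≠ v → φ u = χ u := by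
    intro u hu
    simp [χ, Function.Embedding.setValue, hu, hwφ u]
  have hwi : w ∈ (copyEdge χ i).1 := by
    rw [← hχv]
    exact mem_copyEdge.2 hvi
  have hnot : copyEdge χ i ∉ A ∪ insert x B := fun h => hwS (mem_support h hwi)
  rw [Finset.mem_union, not_or] at hnot
  refine ⟨copyEdge χ i, hnot.1, hnot.2, hnext χ _ _
    (Finset.disjoint_insert_left.2 ⟨hnot.2, Finset.disjoint_insert_right.2 ⟨hxA, hdisj⟩⟩) hcard'
    (fun j hj hji => ?_) fun y hy hvy => ?_⟩
  · rcases hji.eq_or_lt with rfl | hji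
    · exact Finset.mem_insert_self _ _
    · rw [← copyEdge_congr (θ := φ) (θ' := χ) fun u hu =>
        hχ u fun h => hv j hj hji (h ▸ hu)]
      exact Finset.mem_insert_of_mem (hA j hj hji)
  · rw [Finset.insert_union, Finset.mem_insert] at hy
    rw [hχv] at hvy
    exact hy.resolve_right fun h => hwS (mem_support h hvy)

end Building

theorem survives_empty (A : Finset (CompleteEdge 5)) :
    Survives (ramseyWinningSets 5 drawHypergraph) A ∅ := by
  -- Indices 4 to 8 are `e₁, …, e₅`. The initial embedding is arbitrary; each step moves the vertex
  -- `v`, unused by the earlier path edges, to a fresh place.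
  refine survives_of_extension (φ := Fin.valEmbedding) (k := 0) (v := 1) (i := 4) rfl (by decide)
    (by decide) (fun j hj hj' => absurd hj' hj.not_gt) (Finset.disjoint_empty_right A) rfl ?_
  intro φ A B hdisj hcard hA _
  refine survives_of_extension (k := 1) (v := 6) (i := 5) rfl (by decide) (by decide)
    (fun j hj hj' => hA j hj (by omega)) hdisj hcard ?_
  intro φ A B hdisj hcard hA _
  refine survives_of_extension (k := 2) (v := 7) (i := 6) rfl (by decide) (by decide)
    (fun j hj hj' => hA j hj (by omega)) hdisj hcard ?_
  intro φ A B hdisj hcard hA _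
  refine survives_of_extension (k := 3) (v := 8) (i := 7) rfl (by decide) (by decide)
    (fun j hj hj' => hA j hj (by omega)) hdisj hcard ?_
  intro φ A B hdisj hcard hA _
  refine survives_of_extension (k := 4) (v := 9) (i := 8) rfl (by decide) (by decide)
    (fun j hj hj' => hA j hj (by omega)) hdisj hcard ?_
  intro φ A B hdisj hcard hA hfresh
  -- The end 9 was fresh when `e₅` was claimed, so `e₅` is the only claimed edge through it, and it
  -- misses the end 1.
  refine survives_of_path (fun i hi => hA i hi (by omega)) hdisj hcard ?_
  rintro x hx ⟨h1, h9⟩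
  rw [hfresh x hx h9, mem_copyEdge] at h1
  exact absurd h1 (by decide)

theorem theorem1 :
    drawHypergraph.IsUniform 5 ∧
      drawHypergraph.vertexSet.ncard = 10 ∧
      drawHypergraph.edgeSet.ncard = 9 ∧
      IsDraw (ramseyWinningSets 5 drawHypergraph) := by
  refine ⟨?_, ?_, ?_, not_hasWinningStrategy_of_survives survives_empty⟩
  · rintro e ⟨d, hd, rfl⟩
    rw [drawEdges_eq] at hd
    obtain ⟨i, -, rfl⟩ := Finset.mem_image.1 hd
    rw [Set.encard_coe_eq_coe_finsetCard, card_edge]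
  · change (Set.univ : Set (Fin 10)).ncard = 10
    rw [Set.ncard_univ, Nat.card_eq_fintype_card, Fintype.card_fin]
  · have h : drawHypergraph.edgeSet =
        (fun d : Finset (Fin 10) => (d : Set (Fin 10))) '' (drawEdges : Set (Finset (Fin 10))) :=
      rfl
    rw [h, Set.ncard_image_of_injective _ Finset.coe_injective, Set.ncard_coe_finset]
    decide
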